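/- Let $\boldsymbol X=(X_1,\dots,X_d)$ be a random vector in $\mathbb R^d$ whose marginal distribution functions $F_1,\dots,F_d$ are continuous. Let $u_{*j}\in(-\infty,\infty]$ be the upper endpoint of $X_j$, let $b_j(t)=F_j^{-1}(1-1/t)$ for $t>1$, where $F_j^{-1}(p)=\inf\{x: F_j(x)\ge p\}$, and put $\boldsymbol V=\big(1/(1-F_j(X_j))\big)_{j=1}^d$. Operations on vectors are componentwise; $\boldsymbol x\not\le\boldsymbol y$ means that $x_j>y_j$ for at least one $j$; $|\boldsymbol x|_1=\sum_j|x_j|$. Assume the following. (1) There is a non-zero Borel measure $\nu$ on $\mathbb E=[0,\infty)^d\setminus\{\boldsymbol 0\}$, finite on Borel sets bounded away from $\boldsymbol 0$, such that $\lim_{t\to\infty}t\,\mathbb P(t^{-1}\boldsymbol V\in B)=\nu(B)$ for all Borel sets $B\subseteq\mathbb E$ bounded away from $\boldsymbol 0$ with $\nu(\partial B)=0$ (boundary in $\mathbb E$). (2) $\Phi$ is the angular measure of $\boldsymbol V$, i.e. the probability measure on $\Delta_{d-1}=\{\boldsymbol x\in[0,1]^d:|\boldsymbol x|_1=1\}$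 such that $\lim_{t\to\infty}\mathbb P\big(\boldsymbol V/|\boldsymbol V|_1\in A\mid|\boldsymbol V|_1\ge t\big)=\Phi(A)$ for all Borel sets $A\subseteq\Delta_{d-1}$ with $\Phi(\partial A)=0$ (boundary in $\Delta_{d-1}$), and $\Phi$ is concentrated on the open simplex, i.e. on the points of $\Delta_{d-1}$ all of whose coordinates are positive. (3) For every $j$, $\xi_j\in\mathbb R$ and $\sigma_j:(-\infty,u_{*j})\to(0,\infty)$ are such that for all $y>0$ $$\lim_{u\nearrow u_{*j}}\mathbb P\Big(\frac{X_j-u}{\sigma_j(u)}>y\,\Big|\,X_j>u\Big)=(1+\xi_jy)_+^{-1/\xi_j},$$ where $a_+=\max(a,0)$ and the limit is read as $e^{-y}$ if $\xi_j=0$. Let $\boldsymbol Y$ be a multivariate Pareto vector: its law is that of $Y\boldsymbol\Theta$ conditionally on $Y\boldsymbol\Theta\not\le\boldsymbol 1$, where $\mathbb P(Y>y)=1/y$ for $y\ge1$, and $Y$ is independent of $\boldsymbol\Theta\sim\Phi$. Then, with $(y^{\xi}-1)/\xi$ read as $\log y$ if $\xi=0$: (a) For all functions $a_j:(1,\infty)\to(0,\infty)$,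 $j=1,\dots,d$, such that for each $j$ one of the equivalent conditions $$\lim_{t\to\infty}\mathbb P\Big(\frac{X_j-b_j(t)}{a_j(t)}>y\,\Big|\,X_j>b_j(t)\Big)=(1+\xi_jy)_+^{-1/\xi_j}\ \ (y>0),\qquad \lim_{t\to\infty}\frac{b_j(ty)-b_j(t)}{a_j(t)}=\frac{y^{\xi_j}-1}{\xi_j}\ \ (y>0)$$ holds, the law of $(\boldsymbol X-\boldsymbol b(t))/\boldsymbol a(t)$ conditionally on $\boldsymbol X\not\le\boldsymbol b(t)$ converges weakly in $\mathbb R^d$, as $t\to\infty$, to the law of $(\boldsymbol Y^{\boldsymbol\xi}-1)/\boldsymbol\xi$. (b) Consequently, with thresholds $\boldsymbol u(t)=\boldsymbol b(t)$, $t>1$, and $\boldsymbol\sigma(\boldsymbol u(t))=(\sigma_j(u_j(t)))_{j=1}^d$, the law of $(\boldsymbol X-\boldsymbol u(t))/\boldsymbol\sigma(\boldsymbol u(t))$ conditionally on $\boldsymbol X\not\le\boldsymbol u(t)$ converges weakly in $\mathbb R^d$, as $t\to\infty$, to the same limit. -/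

import Mathlib

open MeasureTheory ProbabilityTheory Filter Topology
open scoped BoundedContinuousFunction ENNReal

noncomputable section

namespace MGP

/-- The closed orthant without the origin, `[0, ∞)^d \ {0}`. -/
def puncturedOrthant (d : ℕ) : Set (Fin d → ℝ) := {x | (∀ j, 0 ≤ x j) ∧ x ≠ 0}

/-- The `L₁`-norm on `ℝ^d`. -/
def l1norm {d : ℕ} (x : Fin d → ℝ) : ℝ := ∑ j, |x j|

/-- A set of nonzero vectors of the orthant is bounded away from the origin. -/
def BoundedAwayFromZero {d : ℕ} (B : Set (puncturedOrthant d)) : Prop :=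
  ∃ ε : ℝ, 0 < ε ∧ ∀ x ∈ B, ε ≤ ‖(x : Fin d → ℝ)‖

section Margins

variable {Ω : Type*} [MeasurableSpace Ω] {d : ℕ}

/-- The distribution function `F_j` of the `j`-th component of `X`. -/
def marginCDF (μ : Measure Ω) (X : Ω → Fin d → ℝ) (j : Fin d) (x : ℝ) : ℝ :=
  cdf (μ.map (fun ω => X ω j)) x

/-- The upper endpoint (possibly `+∞`) of the `j`-th component of `X`. -/
def upperEndpoint (μ : Measure Ω) (X : Ω → Fin d → ℝ) (j : Fin d) : EReal :=
  sSup ((fun x : ℝ => (x : EReal)) '' {x : ℝ | marginCDF μ X j x < 1})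

/-- The tail quantile function `b_j(t) = F_j⁻¹(1 - 1/t)`, `t > 1`, where `F_j⁻¹` is the
generalized inverse `F_j⁻¹(p) = inf {x : p ≤ F_j x}`. -/
def tailQuantile (μ : Measure Ω) (X : Ω → Fin d → ℝ) (j : Fin d) (t : ℝ) : ℝ :=
  sInf {x : ℝ | 1 - 1 / t ≤ marginCDF μ X j x}

/-- The vector `V = v(X)`, with components `1 / (1 - F_j (X_j))`. -/
def unitPareto (μ : Measure Ω) (X : Ω → Fin d → ℝ) (ω : Ω) (j : Fin d) : ℝ :=
  1 / (1 - marginCDF μ X j (X ω j))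

/-- Multivariate regular variation of `V` (with scaling `t`): there is a nonzero Borel measure `ν`
on `[0, ∞)^d \ {0}`, finite on Borel sets bounded away from the origin, such that
`t P(V / t ∈ B) → ν B` for all Borel sets `B` bounded away from the origin with `ν (∂B) = 0`. -/
def IsRegularlyVarying (μ : Measure Ω) (V : Ω → Fin d → ℝ) : Prop :=
  ∃ ν : Measure (puncturedOrthant d), ν ≠ 0 ∧
    (∀ B, MeasurableSet B → BoundedAwayFromZero B → ν B < ∞) ∧
    ∀ B, MeasurableSet B → BoundedAwayFromZero B → ν (frontier B) = 0 →
      Tendsto (fun t : ℝ => ENNReal.ofReal t * μ {ω | t⁻¹ • V ω ∈ Subtype.val '' B})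
        atTop (𝓝 (ν B))

/-- `Φ` is the angular measure of `V`: a probability measure on the unit simplex such that
`P(V / |V|₁ ∈ A | |V|₁ ≥ t) → Φ A` for every Borel subset `A` of the simplex with `Φ (∂A) = 0`. -/
def IsAngularMeasure (μ : Measure Ω) (V : Ω → Fin d → ℝ)
    (Φ : Measure (stdSimplex ℝ (Fin d))) : Prop :=
  IsProbabilityMeasure Φ ∧
    ∀ A, MeasurableSet A → Φ (frontier A) = 0 →
      Tendsto (fun t : ℝ => (μ[|{ω | t ≤ l1norm (V ω)}])
          {ω | (l1norm (V ω))⁻¹ • V ω ∈ Subtype.val '' A})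
        atTop (𝓝 (Φ A))

/-- The limit `(1 + ξ y)₊ ^ (-1/ξ)`, read as `exp (-y)` if `ξ = 0`. -/
def gpSurvival (ξ y : ℝ) : ℝ :=
  if ξ = 0 then Real.exp (-y) else (max (1 + ξ * y) 0) ^ (-1 / ξ)

/-- The function `(y ^ ξ - 1) / ξ`, read as `log y` if `ξ = 0`. -/
def boxCox (ξ y : ℝ) : ℝ :=
  if ξ = 0 then Real.log y else (y ^ ξ - 1) / ξ

/-- Generalized Pareto limit of the tail of the `j`-th margin, with shape `ξ` and scaling function
`σ`, which is positive on `(-∞, u_*)`; the limit is along real `u` increasing to the upper endpoint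
`u_* ∈ (-∞, ∞]`. Values of `σ` outside `(-∞, u_*)` play no role. -/
def HasGPTail (μ : Measure Ω) (X : Ω → Fin d → ℝ) (j : Fin d) (ξ : ℝ) (σ : ℝ → ℝ) : Prop :=
  (∀ u : ℝ, (u : EReal) < upperEndpoint μ X j → 0 < σ u) ∧
    ∀ y : ℝ, 0 < y →
      Tendsto (fun u : ℝ => (μ[|{ω | u < X ω j}]).real {ω | y < (X ω j - u) / σ u})
        (comap (fun u : ℝ => (u : EReal)) (𝓝[<] (upperEndpoint μ X j))) (𝓝 (gpSurvival ξ y))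

/-- `a : (1, ∞) → (0, ∞)` is a scaling function for the `j`-th margin with shape `ξ`, in either of
the two usual forms: along the thresholds `b_j(t)` the conditional excesses scaled by `a` have a
generalized Pareto limit, or `(b_j(t y) - b_j(t)) / a(t) → (y ^ ξ - 1) / ξ` for all `y > 0`. -/
def IsTailScaling (μ : Measure Ω) (X : Ω → Fin d → ℝ) (j : Fin d) (ξ : ℝ) (a : ℝ → ℝ) : Prop :=
  (∀ t : ℝ, 1 < t → 0 < a t) ∧
    ((∀ y : ℝ, 0 < y →
        Tendsto (fun t : ℝ => (μ[|{ω | tailQuantile μ X j t < X ω j}]).real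
            {ω | y < (X ω j - tailQuantile μ X j t) / a t})
          atTop (𝓝 (gpSurvival ξ y))) ∨
      (∀ y : ℝ, 0 < y →
        Tendsto (fun t : ℝ => (tailQuantile μ X j (t * y) - tailQuantile μ X j t) / a t)
          atTop (𝓝 (boxCox ξ y))))

/-- The law of `(X - u) / s` (componentwise) conditionally on `X ≰ u`, where `X ≰ u` means that
`X_j > u_j` for at least one `j`. -/
def excessLaw (μ : Measure Ω) (X : Ω → Fin d → ℝ) (u s : Fin d → ℝ) : Measure (Fin d → ℝ) :=
  (μ[|{ω | ¬ X ω ≤ u}]).map (fun ω j => (X ω j - u j) / s j)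

end Margins

/-- The law of the multivariate Pareto vector: the law of `Y Θ` conditionally on `Y Θ ≰ 1`, with
`Y` unit-Pareto (`P(Y > y) = 1 / y` for `y ≥ 1`) and independent of `Θ ∼ Φ`. -/
def multivariatePareto {d : ℕ} (Φ : Measure (stdSimplex ℝ (Fin d))) : Measure (Fin d → ℝ) :=
  (((paretoMeasure 1 1).prod Φ).map
    (fun p : ℝ × stdSimplex ℝ (Fin d) => p.1 • (p.2 : Fin d → ℝ)))[|{z | ¬ z ≤ 1}]

/-- The law of `(Y ^ ξ - 1) / ξ` (componentwise), with `Y` the multivariate Pareto vector. -/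
def mgpLaw {d : ℕ} (Φ : Measure (stdSimplex ℝ (Fin d))) (ξ : Fin d → ℝ) : Measure (Fin d → ℝ) :=
  (multivariatePareto Φ).map (fun y j => boxCox (ξ j) (y j))

/-- Weak convergence, as `t → ∞`, of Borel measures `P t`, which are probability measures for all
`t > 1`, to a probability measure `Q`. -/
def WeaklyConverges {E : Type*} [TopologicalSpace E] [MeasurableSpace E]
    (P : ℝ → Measure E) (Q : Measure E) : Prop :=
  (∀ t : ℝ, 1 < t → IsProbabilityMeasure (P t)) ∧ IsProbabilityMeasure Q ∧
    ∀ f : E →ᵇ ℝ, Tendsto (fun t : ℝ => ∫ x, f x ∂(P t)) atTop (𝓝 (∫ x, f x ∂Q))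

end MGP

end

namespace MGP

/-! Continuity of the margins gives X_j = b_j(V_j) almost surely (`ae_eq_tailQuantile_unitPareto`),
and the events X ≰ b(t) and V ≰ t coincide up to a null set. With W = V/t, the scaled excess is
(b_j(t W_j) - b_j(t)) / a_j(t). It therefore suffices to know the limit law of W given V ≰ t and to
know that y ↦ (b_j(t y) - b_j(t)) / a_j(t) tends to `boxCox (ξ j)` locally uniformly on (0, ∞).

For the first, given |V|₁ ≥ t the pair (|V|₁ / t, V / |V|₁) tends to a unit Pareto variable
independent of Φ (`weaklyConverges_polar`). Multiplying the two and conditioning further on the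
smaller event V ≰ t gives the multivariate Pareto law (`weaklyConverges_multivariatePareto`).

For the second, a generalized Pareto tail limit is inverted into extended regular variation of b_j
(`IsTailScaling.tendsto`), and monotonicity upgrades pointwise to uniform convergence on compacts.
As Φ charges only the open simplex, the limit law is nearly carried by a box [p, q]^d with p > 0,
and an extended continuous mapping argument (`weaklyConverges_map_of_close`) concludes. Part (b) is
the choice a_j(t) = σ_j(b_j(t)). -/

/-! ### The Box–Cox function as inverse of the generalized Pareto survival function. -/

lemma boxCox_one (ξ : ℝ) : boxCox ξ 1 = 0 := by
  unfold boxCox; split_ifs <;> simp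

lemma continuousOn_boxCox (ξ : ℝ) : ContinuousOn (boxCox ξ) (Set.Ioi 0) := by
  unfold boxCox
  split_ifs with h
  · exact Real.continuousOn_log.mono fun x (hx : 0 < x) => hx.ne'
  · exact ((continuousOn_id.rpow_const fun x (hx : 0 < x) => Or.inl hx.ne').sub
      continuousOn_const).div_const _

lemma measurable_boxCox (ξ : ℝ) : Measurable (boxCox ξ) := by
  unfold boxCox
  split_ifs with h
  · exact Real.measurable_log
  · fun_prop

lemma boxCox_mul {ξ y z : ℝ} (hy : 0 < y) (hz : 0 < z) :
    boxCox ξ (y * z) = boxCox ξ y + y ^ ξ * boxCox ξ z := by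
  unfold boxCox
  split_ifs with h
  · simp [h, Real.log_mul hy.ne' hz.ne']
  · rw [Real.mul_rpow hy.le hz.le]; field_simp; ring

lemma boxCox_pos {ξ y : ℝ} (hy : 1 < y) : 0 < boxCox ξ y := by
  unfold boxCox
  split_ifs with h
  · exact Real.log_pos hy
  · rcases lt_or_gt_of_ne h with h | h
    · exact div_pos_of_neg_of_neg (by linarith [Real.rpow_lt_one_of_one_lt_of_neg hy h]) h
    · exact div_pos (by linarith [Real.one_lt_rpow hy h]) h

lemma rpow_rpow_neg_inv {ξ x : ℝ} (hξ : ξ ≠ 0) (hx : 0 < x) : (x ^ ξ) ^ (-1 / ξ) = 1 / x := by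
  rw [← Real.rpow_mul hx.le, mul_div_cancel₀ _ hξ, Real.rpow_neg_one, one_div]

/-- The survival function equals 1/x at `boxCox ξ x`. The sign of ξ decides both the direction of h
after clearing the denominator and the monotonicity of the power -1/ξ, and the two effects cancel.
-/
lemma lt_gpSurvival {ξ x y : ℝ} (hx : 1 < x) (hy : 0 < y) (h : y < boxCox ξ x) :
    1 / x < gpSurvival ξ y := by
  have hx0 : 0 < x := by linarith
  unfold boxCox at h
  unfold gpSurvival
  split_ifs at h ⊢ with h0
  · rw [one_div, ← Real.exp_log hx0, ← Real.exp_neg, Real.exp_lt_exp]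
    linarith
  · rw [← rpow_rpow_neg_inv h0 hx0]
    rcases lt_or_gt_of_ne h0 with h1 | h1
    · rw [lt_div_iff_of_neg h1] at h
      have h2 := Real.rpow_pos_of_pos hx0 ξ
      exact Real.rpow_lt_rpow h2.le (lt_max_of_lt_left (by linarith))
        (div_pos_of_neg_of_neg (by norm_num) h1)
    · rw [lt_div_iff₀ h1] at h
      have h2 := mul_pos h1 hy
      refine Real.rpow_lt_rpow_of_neg (lt_max_of_lt_left (by linarith)) (max_lt (by linarith)
        (Real.rpow_pos_of_pos hx0 ξ)) (div_neg_of_neg_of_pos (by norm_num) h1)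

lemma gpSurvival_lt {ξ x y : ℝ} (hx : 1 < x) (h : boxCox ξ x < y) :
    gpSurvival ξ y < 1 / x := by
  have hx0 : 0 < x := by linarith
  unfold boxCox at h
  unfold gpSurvival
  split_ifs at h ⊢ with h0
  · rw [one_div, ← Real.exp_log hx0, ← Real.exp_neg, Real.exp_lt_exp]
    simpa using h
  · rw [← rpow_rpow_neg_inv h0 hx0]
    have h2 := Real.rpow_pos_of_pos hx0 ξ
    rcases lt_or_gt_of_ne h0 with h1 | h1
    · rw [div_lt_iff_of_neg h1] at h
      exact Real.rpow_lt_rpow (le_max_right _ _) (max_lt (by linarith) h2)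
        (div_pos_of_neg_of_neg (by norm_num) h1)
    · rw [div_lt_iff₀ h1] at h
      exact Real.rpow_lt_rpow_of_neg h2 (lt_max_of_lt_left (by linarith))
        (div_neg_of_neg_of_pos (by norm_num) h1)

/-! ### Extended regular variation and locally uniform convergence. -/

/-- Inversion of a generalized Pareto tail limit along the quantiles of `F`. -/
lemma tendsto_quantile_of_tendsto_survival {F b a : ℝ → ℝ} {ξ : ℝ} (hF : Monotone F)
    (hFb : ∀ t, 1 < t → F (b t) = 1 - 1 / t) (ha : ∀ t, 1 < t → 0 < a t)
    (h : ∀ y, 0 < y → Tendsto (fun t => t * (1 - F (b t + a t * y))) atTop (𝓝 (gpSurvival ξ y)))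
    {x : ℝ} (hx : 1 < x) :
    Tendsto (fun t => (b (t * x) - b t) / a t) atTop (𝓝 (boxCox ξ x)) := by
  have hx0 : 0 < x := by linarith
  have key : ∀ t, 1 < t → t * (1 - F (b (t * x))) = 1 / x := fun t ht => by
    have ht0 : 0 < t := by linarith
    rw [hFb _ (by nlinarith)]
    field_simp
    ring
  refine tendsto_order.2 ⟨fun l hl => ?_, fun u hu => ?_⟩
  -- At such a y the limiting survival exceeds 1/x, the exact value of t(1 - F) at b(tx);
  -- monotonicity of F then orders the arguments. The maximum with 0 is there because h covers only
  -- y > 0.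
  · obtain ⟨y, hy1, hy2⟩ := exists_between (max_lt hl (boxCox_pos (ξ := ξ) hx))
    have hy0 : 0 < y := (le_max_right _ _).trans_lt hy1
    filter_upwards [(tendsto_order.1 (h y hy0)).1 _ (lt_gpSurvival hx hy0 hy2),
      eventually_gt_atTop 1] with t ht1 ht
    rw [← key t ht] at ht1
    have := hF.reflect_lt (a := b t + a t * y) (b := b (t * x)) (by nlinarith)
    refine ((le_max_left _ _).trans_lt hy1).trans ?_
    rw [lt_div_iff₀ (ha t ht)]
    linarith
  · obtain ⟨y, hy1, hy2⟩ := exists_between hu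
    have hy0 : 0 < y := (boxCox_pos hx).trans hy1
    filter_upwards [(tendsto_order.1 (h y hy0)).2 _ (gpSurvival_lt hx hy1),
      eventually_gt_atTop 1] with t ht1 ht
    rw [← key t ht] at ht1
    have := hF.reflect_lt (a := b (t * x)) (b := b t + a t * y) (by nlinarith)
    refine lt_trans ?_ hy2
    rw [div_lt_iff₀ (ha t ht)]
    linarith

/-- Extended regular variation for arguments above `1` extends to all positive arguments. -/
lemma tendsto_extendedRegularVariation {b a : ℝ → ℝ} {ξ : ℝ} (ha : ∀ t, 1 < t → 0 < a t)
    (h : ∀ x, 1 < x → Tendsto (fun t => (b (t * x) - b t) / a t) atTop (𝓝 (boxCox ξ x)))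
    {x : ℝ} (hx : 0 < x) :
    Tendsto (fun t => (b (t * x) - b t) / a t) atTop (𝓝 (boxCox ξ x)) := by
  rcases lt_trichotomy x 1 with hx1 | rfl | hx1
  · have hy : 1 < x⁻¹ := (one_lt_inv₀ hx).2 hx1
    have hy0 : 0 < x⁻¹ := inv_pos.2 hx
    have hmul : ∀ c : ℝ, 0 < c → Tendsto (fun t : ℝ => t * c) atTop atTop := fun c hc =>
      tendsto_id.atTop_mul_const hc
    have hy2 : boxCox ξ x⁻¹ ≠ 0 := (boxCox_pos hy).ne'
    -- the ratio of the scalings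
    have hratio : Tendsto (fun t => a (t * x⁻¹) / a t) atTop (𝓝 ((x⁻¹) ^ ξ)) := by
      -- The increment b(t/x²) - b(t/x) is normalised once by a(t) and once by a(t/x); the quotient
      -- of the two limits is that of a(t/x)/a(t).
      have h1 := (h (x⁻¹ * x⁻¹) (by nlinarith)).sub (h _ hy)
      have h2 := (h _ hy).comp (hmul _ hy0)
      have h3 := h1.div h2 hy2
      rw [boxCox_mul hy0 hy0, add_sub_cancel_left, mul_div_cancel_right₀ _ hy2] at h3
      refine h3.congr' ?_
      filter_upwards [eventually_gt_atTop 1, (h2.eventually_ne hy2)] with t ht hne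
      have h4 := (ha t ht).ne'
      have h5 := (ha (t * x⁻¹) (by nlinarith)).ne'
      simp only [Function.comp_def, Pi.div_apply] at hne ⊢
      have h6 : b (t * x⁻¹ * x⁻¹) - b (t * x⁻¹) ≠ 0 := fun h => hne (by rw [h, zero_div])
      rw [← mul_assoc, ← sub_div, sub_sub_sub_cancel_right]
      generalize b (t * x⁻¹ * x⁻¹) - b (t * x⁻¹) = u at h6 ⊢
      generalize a (t * x⁻¹) = v at h5 ⊢
      field_simp
    -- With s = tx, b(tx) - b(t) = -(b(s/x) - b(s)) and a(t) = a(s/x), which reduces x < 1 to the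
    -- argument 1/x > 1.
    have h1 := ((h _ hy).div hratio (Real.rpow_pos_of_pos hy0 ξ).ne').neg
    have h2 := h1.comp (hmul x hx)
    have hlim : -(boxCox ξ x⁻¹ / x⁻¹ ^ ξ) = boxCox ξ x := by
      have h3 := boxCox_mul (ξ := ξ) hy0 hx
      rw [inv_mul_cancel₀ hx.ne', boxCox_one] at h3
      have := (Real.rpow_pos_of_pos hy0 ξ).ne'
      rw [← neg_div, div_eq_iff this]
      linarith
    rw [hlim] at h2
    refine h2.congr' ?_
    filter_upwards [eventually_gt_atTop 1, (hmul x hx).eventually_gt_atTop 1] with t ht ht'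
    have h4 := (ha t ht).ne'
    have h5 := (ha (t * x) ht').ne'
    simp only [Function.comp_def, Pi.div_apply]
    rw [mul_inv_cancel_right₀ hx.ne']
    field_simp
    ring
  · simp [boxCox_one]
  · exact h x hx1

/-- Monotone functions converging pointwise to a continuous function on a compact interval converge
uniformly. -/
lemma eventually_forall_abs_sub_le_of_monotoneOn {ι : Type*} {l : Filter ι} {h : ι → ℝ → ℝ}
    {D : ℝ → ℝ} {p q : ℝ} (hm : ∀ᶠ i in l, MonotoneOn (h i) (Set.Icc p q))
    (hD : ContinuousOn D (Set.Icc p q))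
    (hlim : ∀ y ∈ Set.Icc p q, Tendsto (fun i => h i y) l (𝓝 (D y))) {ε : ℝ} (hε : 0 < ε) :
    ∀ᶠ i in l, ∀ y ∈ Set.Icc p q, |h i y - D y| ≤ ε := by
  refine isCompact_Icc.induction_on (p := fun s => ∀ᶠ i in l, ∀ y ∈ s, |h i y - D y| ≤ ε)
    ?_ ?_ ?_ ?_
  · simp
  · exact fun s t hst ht => ht.mono fun i hi y hy => hi y (hst hy)
  · intro s t hs ht
    filter_upwards [hs, ht] with i h1 h2 y hy
    exact hy.elim (h1 y) (h2 y)
  · intro x hx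
    obtain ⟨δ, hδ, hδD⟩ := Metric.continuousOn_iff.1 hD x hx (ε / 4) (by positivity)
    have hcl : ∀ z, dist z x ≤ δ / 2 → z ∈ Set.Icc p q → |D z - D x| < ε / 4 := fun z hz hzm =>
      hδD z hzm (by linarith)
    refine ⟨Set.Icc p q ∩ Metric.closedBall x (δ / 2), Filter.inter_mem self_mem_nhdsWithin
      (mem_nhdsWithin_of_mem_nhds (Metric.closedBall_mem_nhds x (by positivity))), ?_⟩
    obtain ⟨hx1, hx2⟩ := hx
    set L := max p (x - δ / 2)
    -- Monotonicity traps h i y between its values at L and U; convergence at these two points and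
    -- the small oscillation of D on [L, U] give an error below 3ε/4.
    set U := min q (x + δ / 2)
    have hLx : L ≤ x := max_le hx1 (by linarith)
    have hxU : x ≤ U := le_min hx2 (by linarith)
    have hL : L ∈ Set.Icc p q := ⟨le_max_left _ _, hLx.trans hx2⟩
    have hU : U ∈ Set.Icc p q := ⟨hx1.trans hxU, min_le_left _ _⟩
    have hLx' : x - δ / 2 ≤ L := le_max_right _ _
    have hUx' : U ≤ x + δ / 2 := min_le_right _ _
    have hLD := abs_lt.1 (hcl L (by rw [Real.dist_eq, abs_le]; constructor <;> linarith) hL)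
    have hUD := abs_lt.1 (hcl U (by rw [Real.dist_eq, abs_le]; constructor <;> linarith) hU)
    filter_upwards [hm, Metric.tendsto_nhds.1 (hlim L hL) (ε / 4) (by positivity),
      Metric.tendsto_nhds.1 (hlim U hU) (ε / 4) (by positivity)] with i hi hiL hiU y ⟨hy, hyx⟩
    have hyD := abs_lt.1 (hcl y hyx hy)
    rw [Metric.mem_closedBall, Real.dist_eq, abs_le] at hyx
    rw [Real.dist_eq, abs_lt] at hiL hiU
    have h1 := hi hL hy (max_le hy.1 (by linarith))
    have h2 := hi hy hU (le_min hy.2 (by linarith))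
    rw [abs_le]
    constructor <;> linarith

/-! ### Level sets of a continuous distribution function. -/

lemma exists_cdf_eq {ν : Measure ℝ} (hF : Continuous (cdf ν)) {p : ℝ}
    (h0 : 0 < p) (h1 : p < 1) : ∃ x, cdf ν x = p := by
  obtain ⟨x, hx⟩ := ((tendsto_order.1 (tendsto_cdf_atBot ν)).2 p h0).exists
  obtain ⟨y, hy⟩ := ((tendsto_order.1 (tendsto_cdf_atTop ν)).1 p h1).exists
  exact mem_range_of_exists_le_of_exists_ge hF ⟨x, hx.le⟩ ⟨y, hy.le⟩

/-- A continuous distribution function takes each given value with probability zero. -/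
lemma measure_cdf_eq_const (ν : Measure ℝ) [IsProbabilityMeasure ν] (hF : Continuous (cdf ν))
    (c : ℝ) : ν {x | cdf ν x = c} = 0 := by
  rw [← measureReal_eq_zero_iff]
  refine le_antisymm (le_of_forall_pos_le_add fun ε hε => ?_) measureReal_nonneg
  have hmono := monotone_cdf ν
  rw [zero_add]
  rcases le_or_gt c 0 with hc | hc
  -- The value 1/2 only keeps the level inside (0, 1), where it is attained.
  · obtain ⟨x, hx⟩ := exists_cdf_eq hF (p := min ε (1 / 2)) (by positivity)
      ((min_le_right _ _).trans_lt (by norm_num))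
    have hx0 : 0 < cdf ν x := by rw [hx]; positivity
    calc ν.real {x | cdf ν x = c} ≤ ν.real (Set.Iic x) := measureReal_mono fun z hz =>
          (hmono.reflect_lt (hz.trans_le hc |>.trans_lt hx0)).le
      _ ≤ ε := by rw [← cdf_eq_real, hx]; exact min_le_left _ _
  rcases le_or_gt 1 c with hc1 | hc1
  · obtain ⟨x, hx⟩ := exists_cdf_eq hF (p := max (1 - ε) (1 / 2)) (by positivity)
      (max_lt (by linarith) (by norm_num))
    have hx0 : cdf ν x < 1 := by rw [hx]; exact max_lt (by linarith) (by norm_num)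
    calc ν.real {x | cdf ν x = c} ≤ ν.real (Set.Iic x)ᶜ := measureReal_mono fun z hz =>
          not_le.2 (hmono.reflect_lt (hx0.trans_le (hc1.trans_eq hz.symm)))
      _ ≤ ε := by
        rw [probReal_compl_eq_one_sub measurableSet_Iic, ← cdf_eq_real, hx]
        linarith [le_max_left (1 - ε) (1 / 2)]
  · obtain ⟨p, hp1, hp2⟩ := exists_between (max_lt hc (show c - ε / 2 < c by linarith))
    obtain ⟨q, hq1, hq2⟩ := exists_between (lt_min hc1 (show c < c + ε / 2 by linarith))
    obtain ⟨hp3, hp4⟩ := max_lt_iff.1 hp1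
    obtain ⟨hq3, hq4⟩ := lt_min_iff.1 hq2
    obtain ⟨x, hx⟩ := exists_cdf_eq hF hp3 (hp2.trans hc1)
    obtain ⟨y, hy⟩ := exists_cdf_eq hF (hc.trans hq1) hq3
    have hxy : x ≤ y := (hmono.reflect_lt (by linarith)).le
    calc ν.real {x | cdf ν x = c}
      _ ≤ ν.real (Set.Iic y \ Set.Iic x) := measureReal_mono fun z hz => by
          rw [Set.mem_ofPred_eq] at hz
          exact ⟨(hmono.reflect_lt (by linarith)).le, not_le.2 (hmono.reflect_lt (by linarith))⟩
      _ ≤ ε := by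
        rw [measureReal_sdiff (Set.Iic_subset_Iic.2 hxy) measurableSet_Iic, ← cdf_eq_real,
          ← cdf_eq_real]
        linarith

/-! ### Tail quantiles and the probability integral transform. -/

section Margins

variable {Ω : Type*} [MeasurableSpace Ω] {μ : Measure Ω} {d : ℕ} {X : Ω → Fin d → ℝ} {j : Fin d}

lemma monotone_marginCDF : Monotone (marginCDF μ X j) := monotone_cdf _

lemma tailQuantile_mem (hF : Continuous (marginCDF μ X j)) {t : ℝ} (ht : 1 < t) :
    marginCDF μ X j (tailQuantile μ X j t) = 1 - 1 / t ∧
      ∀ x, 1 - 1 / t ≤ marginCDF μ X j x → tailQuantile μ X j t ≤ x := by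
  have hp0 : 0 < 1 - 1 / t := by
    rw [sub_pos, div_lt_one (by linarith)]; exact ht
  have hp1 : 1 - 1 / t < 1 := by
    have : 0 < 1 / t := by positivity
    linarith
  obtain ⟨x, hx⟩ : ∃ x, marginCDF μ X j x = 1 - 1 / t := exists_cdf_eq hF hp0 hp1
  have hbdd : BddBelow {x : ℝ | 1 - 1 / t ≤ marginCDF μ X j x} := by
    obtain ⟨y, hy⟩ := ((tendsto_order.1 (tendsto_cdf_atBot (μ.map fun ω => X ω j))).2 _ hp0).exists
    exact ⟨y, fun z hz =>
      ((monotone_marginCDF (μ := μ) (X := X) (j := j)).reflect_lt (hy.trans_le hz)).le⟩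
  have hmin : ∀ x, 1 - 1 / t ≤ marginCDF μ X j x → tailQuantile μ X j t ≤ x :=
    fun x hx => csInf_le hbdd hx
  refine ⟨le_antisymm ((monotone_marginCDF (hmin x hx.ge)).trans_eq hx) ?_, hmin⟩
  exact (isClosed_le continuous_const hF).csInf_mem ⟨x, hx.ge⟩ hbdd

lemma marginCDF_tailQuantile (hF : Continuous (marginCDF μ X j)) {t : ℝ} (ht : 1 < t) :
    marginCDF μ X j (tailQuantile μ X j t) = 1 - 1 / t := (tailQuantile_mem hF ht).1

lemma strictMonoOn_tailQuantile (hF : Continuous (marginCDF μ X j)) :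
    StrictMonoOn (tailQuantile μ X j) (Set.Ioi 1) := fun s hs t ht hst => by
  refine (monotone_marginCDF (μ := μ) (X := X) (j := j)).reflect_lt ?_
  rw [marginCDF_tailQuantile hF hs, marginCDF_tailQuantile hF ht]
  have := one_div_lt_one_div_of_lt (zero_lt_one.trans hs) hst
  linarith

lemma tailQuantile_lt_upperEndpoint (hF : Continuous (marginCDF μ X j)) {t : ℝ} (ht : 1 < t) :
    (tailQuantile μ X j t : EReal) < upperEndpoint μ X j := by
  have ht1 : 1 < t + 1 := by linarith
  refine lt_of_lt_of_le (EReal.coe_lt_coe_iff.2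
    (strictMonoOn_tailQuantile hF ht ht1 (lt_add_one t))) (le_sSup ⟨_, ?_, rfl⟩)
  rw [Set.mem_ofPred_eq, marginCDF_tailQuantile hF ht1]
  have : 0 < 1 / (t + 1) := by positivity
  linarith

lemma tendsto_tailQuantile (hF : Continuous (marginCDF μ X j)) :
    Tendsto (tailQuantile μ X j) atTop
      (comap (fun u : ℝ => (u : EReal)) (𝓝[<] (upperEndpoint μ X j))) := by
  rw [tendsto_comap_iff]
  refine tendsto_nhdsWithin_iff.2 ⟨tendsto_order.2 ⟨fun l hl => ?_, fun u hu => ?_⟩, ?_⟩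
  · obtain ⟨_, ⟨x, hx, rfl⟩, hlx⟩ := lt_sSup_iff.1 hl
    have hx : 0 < 1 - marginCDF μ X j x := sub_pos.2 hx
    filter_upwards [eventually_gt_atTop 1, eventually_gt_atTop (1 / (1 - marginCDF μ X j x))]
      with t ht htx
    refine hlx.trans (EReal.coe_lt_coe_iff.2
      ((monotone_marginCDF (μ := μ) (X := X) (j := j)).reflect_lt ?_))
    rw [marginCDF_tailQuantile hF ht]
    have := (one_div_lt hx (by linarith)).1 htx
    linarith
  · filter_upwards [eventually_gt_atTop 1] with t ht
    exact (tailQuantile_lt_upperEndpoint hF ht).trans hu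
  · filter_upwards [eventually_gt_atTop 1] with t ht
    exact tailQuantile_lt_upperEndpoint hF ht

/-- Where F_j(X_j) = 1 the quotient 1/0 is 0, so the bound holds everywhere; that event is null when
F_j is continuous. -/
lemma unitPareto_nonneg (ω : Ω) (j : Fin d) : 0 ≤ unitPareto μ X ω j :=
  one_div_nonneg.2 (sub_nonneg.2 (cdf_le_one _ _))

lemma measurable_unitPareto (hX : Measurable X) : Measurable (unitPareto μ X) := by
  have : ∀ j, Measurable (marginCDF μ X j) := fun j => monotone_marginCDF.measurable
  refine measurable_pi_lambda _ fun j => ?_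
  unfold unitPareto
  fun_prop

/-- Reduces part (b) to part (a): b_j(t) stays strictly below the upper endpoint and tends to it, so
the limit in u may be taken along u = b_j(t). -/
lemma HasGPTail.isTailScaling (hF : Continuous (marginCDF μ X j)) {ξ : ℝ} {σ : ℝ → ℝ}
    (h : HasGPTail μ X j ξ σ) :
    IsTailScaling μ X j ξ (fun t => σ (tailQuantile μ X j t)) :=
  ⟨fun _ ht => h.1 _ (tailQuantile_lt_upperEndpoint hF ht),
    Or.inl fun y hy => (h.2 y hy).comp (tendsto_tailQuantile hF)⟩

variable [IsProbabilityMeasure μ]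

lemma isProbabilityMeasure_margin (hX : Measurable X) (j : Fin d) :
    IsProbabilityMeasure (μ.map fun ω => X ω j) :=
  Measure.isProbabilityMeasure_map (by fun_prop)

lemma marginCDF_eq (hX : Measurable X) (x : ℝ) :
    marginCDF μ X j x = μ.real {ω | X ω j ≤ x} := by
  have := isProbabilityMeasure_margin (μ := μ) hX j
  rw [marginCDF, cdf_eq_real, measureReal_def, Measure.map_apply (by fun_prop) measurableSet_Iic]
  rfl

lemma measureReal_lt (hX : Measurable X) (x : ℝ) :
    μ.real {ω | x < X ω j} = 1 - marginCDF μ X j x := by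
  rw [marginCDF_eq hX, ← probReal_compl_eq_one_sub (measurableSet_le (by fun_prop) (by fun_prop))]
  congr 1
  ext ω
  simp

lemma measureReal_tailQuantile_lt (hX : Measurable X) (hF : Continuous (marginCDF μ X j)) {t : ℝ}
    (ht : 1 < t) : μ.real {ω | tailQuantile μ X j t < X ω j} = 1 / t := by
  rw [measureReal_lt hX, marginCDF_tailQuantile hF ht]
  ring

/-- Almost surely `X_j` is recovered from its probability integral transform. -/
lemma ae_eq_tailQuantile_unitPareto (hX : Measurable X) (hF : Continuous (marginCDF μ X j)) :
    ∀ᵐ ω ∂μ, 1 < unitPareto μ X ω j ∧ tailQuantile μ X j (unitPareto μ X ω j) = X ω j := by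
  have := isProbabilityMeasure_margin (μ := μ) hX j
  have hlev : ∀ c, ∀ᵐ ω ∂μ, marginCDF μ X j (X ω j) ≠ c := fun c => by
    have h1 := measure_cdf_eq_const (μ.map fun ω => X ω j) hF c
    exact ae_of_ae_map (f := fun ω => X ω j) (p := fun x => marginCDF μ X j x ≠ c) (by fun_prop)
      (by simpa [ae_iff] using! h1)
  -- Minimality gives b(V) ≤ X. If the inequality were strict, F would be constant from b(V) to X,
  -- hence equal to F(X) at a rational point; this discards only countably many null level sets.
  have hq : ∀ᵐ ω ∂μ, ∀ q : ℚ, marginCDF μ X j (X ω j) ≠ marginCDF μ X j q :=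
    ae_all_iff.2 fun q => hlev _
  filter_upwards [hq, hlev 0, hlev 1] with ω h h0 h1
  have h0 : 0 < marginCDF μ X j (X ω j) := lt_of_le_of_ne (cdf_nonneg _ _) h0.symm
  have h1 : marginCDF μ X j (X ω j) < 1 := lt_of_le_of_ne (cdf_le_one _ _) h1
  have hV : 1 < unitPareto μ X ω j := by
    rw [unitPareto, lt_div_iff₀ (by linarith)]
    linarith
  have hp : 1 - 1 / unitPareto μ X ω j = marginCDF μ X j (X ω j) := by
    rw [unitPareto, one_div_one_div]
    ring
  obtain ⟨hb1, hb2⟩ := tailQuantile_mem hF hV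
  rw [hp] at hb1 hb2
  refine ⟨hV, (hb2 _ le_rfl).eq_of_not_lt fun hlt => ?_⟩
  obtain ⟨q, hq1, hq2⟩ := exists_rat_btwn hlt
  exact h q (le_antisymm (hb1.symm.trans_le (monotone_marginCDF hq1.le))
    (monotone_marginCDF hq2.le))

lemma ae_tailQuantile_lt_iff (hX : Measurable X) (hF : Continuous (marginCDF μ X j)) {t : ℝ}
    (ht : 1 < t) : ∀ᵐ ω ∂μ, tailQuantile μ X j t < X ω j ↔ t < unitPareto μ X ω j := by
  filter_upwards [ae_eq_tailQuantile_unitPareto hX hF] with ω ⟨h1, h2⟩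
  rw [← (strictMonoOn_tailQuantile hF).lt_iff_lt ht h1, h2]

lemma measureReal_lt_unitPareto (hX : Measurable X) (hF : Continuous (marginCDF μ X j)) {t : ℝ}
    (ht : 1 < t) : μ.real {ω | t < unitPareto μ X ω j} = 1 / t := by
  rw [← measureReal_tailQuantile_lt hX hF ht]
  refine measureReal_congr ?_
  filter_upwards [ae_tailQuantile_lt_iff hX hF ht] with ω h
  exact propext h.symm

lemma ae_not_le_iff (hX : Measurable X) (hF : ∀ j, Continuous (marginCDF μ X j)) {t : ℝ}
    (ht : 1 < t) :
    {ω | ¬ X ω ≤ fun j => tailQuantile μ X j t} =ᵐ[μ] {ω | ¬ unitPareto μ X ω ≤ fun _ => t} := by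
  filter_upwards [ae_all_iff.2 fun j => ae_tailQuantile_lt_iff hX (hF j) ht] with ω h
  refine propext (show (¬ X ω ≤ fun j => tailQuantile μ X j t) ↔ ¬ unitPareto μ X ω ≤ fun _ => t
    from ?_)
  simp only [Pi.le_def, not_forall, not_le, h]

lemma cond_excess_eq (hX : Measurable X) (hF : Continuous (marginCDF μ X j)) {t a y : ℝ}
    (ht : 1 < t) (ha : 0 < a) (hy : 0 < y) :
    (μ[|{ω | tailQuantile μ X j t < X ω j}]).real {ω | y < (X ω j - tailQuantile μ X j t) / a} =
      t * (1 - marginCDF μ X j (tailQuantile μ X j t + a * y)) := by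
  have hm : MeasurableSet {ω | tailQuantile μ X j t < X ω j} :=
    measurableSet_lt (by fun_prop) (by fun_prop)
  rw [measureReal_def, cond_apply hm, ENNReal.toReal_mul, ENNReal.toReal_inv, ← measureReal_def,
    ← measureReal_def, measureReal_tailQuantile_lt hX hF ht, ← measureReal_lt hX, one_div, inv_inv]
  congr 2
  ext ω
  simp only [Set.mem_inter_iff, Set.mem_ofPred_eq, lt_div_iff₀ ha]
  have := mul_pos ha hy
  constructor
  · rintro ⟨-, h⟩; linarith
  · intro h; constructor <;> linarith

/-- Both forms of the scaling condition give the extended regular variation of the tail quantile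
function. -/
lemma IsTailScaling.tendsto (hX : Measurable X) (hF : Continuous (marginCDF μ X j)) {ξ : ℝ}
    {a : ℝ → ℝ} (h : IsTailScaling μ X j ξ a) {y : ℝ} (hy : 0 < y) :
    Tendsto (fun t : ℝ => (tailQuantile μ X j (t * y) - tailQuantile μ X j t) / a t)
      atTop (𝓝 (boxCox ξ y)) := by
  obtain ⟨ha, h | h⟩ := h
  · refine tendsto_extendedRegularVariation ha (fun x hx => ?_) hy
    refine tendsto_quantile_of_tendsto_survival (F := marginCDF μ X j) monotone_marginCDF
      (fun t => marginCDF_tailQuantile hF) ha (fun z hz => (h z hz).congr' ?_) hx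
    filter_upwards [eventually_gt_atTop 1] with t ht
    exact cond_excess_eq hX hF ht (ha t ht) hz
  · exact h y hy

end Margins

/-! ### Weak convergence along t > 1: conditioning and continuous mapping. -/

section Weak

variable {E : Type*} [MeasurableSpace E]

/-- A probability measure, bundled. -/
def bundle (P : Measure E) (hP : IsProbabilityMeasure P) : ProbabilityMeasure E := ⟨P, hP⟩

variable [TopologicalSpace E]

/-- Indexing by `Set.Ioi 1`, where every P t is a probability measure, gives access to the topology
of `ProbabilityMeasure` and the portmanteau theorem without changing limits at infinity. -/
lemma weaklyConverges_iff_tendsto [OpensMeasurableSpace E] {P : ℝ → Measure E} {Q : Measure E}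
    (hP : ∀ t : Set.Ioi (1 : ℝ), IsProbabilityMeasure (P t)) (hQ : IsProbabilityMeasure Q) :
    WeaklyConverges P Q ↔
      Tendsto (fun t : Set.Ioi (1 : ℝ) => bundle (P t) (hP t)) atTop (𝓝 (bundle Q hQ)) := by
  rw [ProbabilityMeasure.tendsto_iff_forall_integral_tendsto]
  constructor
  · exact fun h f => tendsto_comp_val_Ioi_atTop.2 (h.2.2 f)
  · exact fun h => ⟨fun t ht => hP ⟨t, ht⟩, hQ, fun f =>
      (tendsto_comp_val_Ioi_atTop (f := fun t => ∫ x, f x ∂(P t)) (a := (1 : ℝ))).1 (h f)⟩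

instance : (atTop : Filter (Set.Ioi (1 : ℝ))).IsCountablyGenerated := by
  rw [atTop_Ioi_eq]
  infer_instance

variable {P : ℝ → Measure E} {Q : Measure E}

lemma WeaklyConverges.congr {P' : ℝ → Measure E} (h : WeaklyConverges P Q)
    (hP : ∀ t, 1 < t → P t = P' t) : WeaklyConverges P' Q := by
  refine ⟨fun t ht => ?_, h.2.1, fun f => (h.2.2 f).congr' ?_⟩
  · rw [← hP t ht]
    exact h.1 t ht
  · filter_upwards [eventually_gt_atTop 1] with t ht
    rw [hP t ht]

lemma WeaklyConverges.tendsto [OpensMeasurableSpace E] (h : WeaklyConverges P Q) :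
    Tendsto (fun t : Set.Ioi (1 : ℝ) => bundle (P t) (h.1 t t.2)) atTop (𝓝 (bundle Q h.2.1)) :=
  (weaklyConverges_iff_tendsto _ _).1 h

lemma WeaklyConverges.tendsto_measure [OpensMeasurableSpace E] [HasOuterApproxClosed E]
    (h : WeaklyConverges P Q) {A : Set E} (hA : Q (frontier A) = 0) :
    Tendsto (fun t => P t A) atTop (𝓝 (Q A)) :=
  (tendsto_comp_val_Ioi_atTop (a := (1 : ℝ))).1
    (ProbabilityMeasure.tendsto_measure_of_null_frontier_of_tendsto' h.tendsto hA)

lemma WeaklyConverges.eventually_measure_lt [OpensMeasurableSpace E] [HasOuterApproxClosed E]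
    (h : WeaklyConverges P Q) {A : Set E} (hA : IsClosed A) {c : ℝ≥0∞} (hc : Q A < c) :
    ∀ᶠ t in atTop, P t A < c := by
  have h1 := eventually_lt_of_limsup_lt
    ((ProbabilityMeasure.limsup_measure_closed_le_of_tendsto h.tendsto hA).trans_lt hc)
  rw [← map_val_Ioi_atTop (1 : ℝ)]
  exact h1

lemma WeaklyConverges.map [OpensMeasurableSpace E] {E' : Type*} [TopologicalSpace E']
    [MeasurableSpace E'] [BorelSpace E'] (h : WeaklyConverges P Q) {g : E → E'}
    (hg : Continuous g) : WeaklyConverges (fun t => (P t).map g) (Q.map g) := by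
  have := h.2.1
  refine ⟨fun t ht => ?_, Measure.isProbabilityMeasure_map hg.measurable.aemeasurable, fun f => ?_⟩
  · have := h.1 t ht
    exact Measure.isProbabilityMeasure_map hg.measurable.aemeasurable
  · simp_rw [integral_map hg.measurable.aemeasurable
      f.continuous.measurable.aestronglyMeasurable]
    exact h.2.2 (f.compContinuous ⟨g, hg⟩)

lemma weaklyConverges_of_forall_tendsto_measure [TopologicalSpace.PseudoMetrizableSpace E]
    [OpensMeasurableSpace E]
    (hP : ∀ t, 1 < t → IsProbabilityMeasure (P t)) (hQ : IsProbabilityMeasure Q)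
    (h : ∀ A, MeasurableSet A → Q (frontier A) = 0 → Tendsto (fun t => P t A) atTop (𝓝 (Q A))) :
    WeaklyConverges P Q := by
  rw [weaklyConverges_iff_tendsto (fun t => hP t t.2) hQ]
  refine tendsto_of_forall_isClosed_limsup_le' fun F hF => ?_
  exact limsup_measure_closed_le_of_forall_tendsto_measure
    (fun hA hA0 => tendsto_comp_val_Ioi_atTop.2 (h _ hA hA0)) F hF

/-- Weak convergence is preserved by conditioning on a continuity set of positive mass. -/
lemma WeaklyConverges.cond [TopologicalSpace.PseudoMetrizableSpace E] [OpensMeasurableSpace E]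
    (h : WeaklyConverges P Q) {C : Set E} (hC : MeasurableSet C) (hCf : Q (frontier C) = 0)
    (hQC : Q C ≠ 0) (hPC : ∀ t, 1 < t → P t C ≠ 0) :
    WeaklyConverges (fun t => (P t)[|C]) (Q[|C]) := by
  have := h.2.1
  refine weaklyConverges_of_forall_tendsto_measure (fun t ht => ?_) (cond_isProbabilityMeasure hQC)
    fun A hA hA0 => ?_
  · have := h.1 t ht
    exact cond_isProbabilityMeasure (hPC t ht)
  · simp_rw [cond_apply hC]
    -- Nullity under the conditional law only controls C ∩ frontier A; the other boundary points of
    -- C ∩ A lie in frontier C.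
    have hf : Q (frontier (C ∩ A)) = 0 := by
      rw [cond_apply hC, mul_eq_zero, ENNReal.inv_eq_zero] at hA0
      have h1 := hA0.resolve_left (measure_ne_top Q C)
      refine measure_mono_null (t := frontier C ∪ C ∩ frontier A) (fun x hx => ?_)
        (measure_union_null hCf h1)
      rcases frontier_inter_subset C A hx with ⟨h2, -⟩ | ⟨h2, h3⟩
      · exact Or.inl h2
      · by_cases hxC : x ∈ C
        · exact Or.inr ⟨hxC, h3⟩
        · exact Or.inl ⟨h2, fun h => hxC (interior_subset h)⟩
    exact ENNReal.Tendsto.mul (tendsto_inv_iff.2 (h.tendsto_measure hCf))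
      (Or.inr (measure_ne_top _ _)) (h.tendsto_measure hf)
      (Or.inr (ENNReal.inv_ne_top.2 hQC))

/-- Off B the Lipschitz bound costs Lη; on B the oscillation of f costs C. -/
lemma abs_integral_comp_sub_le {α E' : Type*} [MeasurableSpace α] [PseudoMetricSpace E']
    [MeasurableSpace E'] [BorelSpace E'] (π : Measure α) [IsProbabilityMeasure π] {f : E' → ℝ}
    {C : ℝ} {L : NNReal} (hC : ∀ x y, dist (f x) (f y) ≤ C) (hL : LipschitzWith L f)
    {u v : α → E'} (hu : Measurable u) (hv : Measurable v) {B : Set α} (hB : MeasurableSet B)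
    {η : ℝ} (hη : 0 ≤ η) (huv : ∀ᵐ x ∂π, x ∉ B → dist (u x) (v x) ≤ η) :
    |∫ x, f (u x) ∂π - ∫ x, f (v x) ∂π| ≤ L * η + C * π.real B := by
  let fb : E' →ᵇ ℝ := ⟨⟨f, hL.continuous⟩, C, hC⟩
  have hi : ∀ w : α → E', Measurable w → Integrable (fun x => f (w x)) π := fun w hw =>
    Integrable.of_bound (hL.continuous.measurable.comp hw).aestronglyMeasurable ‖fb‖
      (ae_of_all _ fun x => fb.norm_coe_le_norm (w x))
  rw [← integral_sub (hi u hu) (hi v hv)]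
  have hint : Integrable (fun x => L * η + B.indicator (fun _ => C) x) π :=
    (integrable_const _).add ((integrable_const C).indicator hB)
  have hpt : ∀ᵐ x ∂π, ‖f (u x) - f (v x)‖ ≤ L * η + B.indicator (fun _ => C) x := by
    filter_upwards [huv] with x hx
    by_cases hxB : x ∈ B
    · rw [Set.indicator_of_mem hxB]
      have := hC (u x) (v x)
      rw [Real.dist_eq] at this
      rw [Real.norm_eq_abs]
      have : 0 ≤ L * η := by positivity
      linarith
    · rw [Set.indicator_of_notMem hxB, add_zero]
      exact (hL.dist_le_mul _ _).trans (mul_le_mul_of_nonneg_left (hx hxB) L.2)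
  refine (norm_integral_le_of_norm_le hint hpt).trans_eq ?_
  rw [integral_add (integrable_const _) ((integrable_const C).indicator hB),
    integral_indicator_const _ hB]
  simp [mul_comm]

/-- Extended continuous mapping: if `W t` converges weakly to `Q` and `Z t` is uniformly close to
`g (W t)` on open sets of arbitrarily large mass on which `g` agrees with a continuous function,
then `Z t` converges weakly to the image of `Q` under `g`. -/
lemma weaklyConverges_map_of_close [OpensMeasurableSpace E] [HasOuterApproxClosed E]
    {Ω E' : Type*} [MeasurableSpace Ω]
    [PseudoMetricSpace E'] [MeasurableSpace E'] [BorelSpace E'] {ρ : ℝ → Measure Ω}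
    (hρ : ∀ t, 1 < t → IsProbabilityMeasure (ρ t)) {W : ℝ → Ω → E} {Z : ℝ → Ω → E'}
    (hW : ∀ t, Measurable (W t)) (hZ : ∀ t, Measurable (Z t)) {g : E → E'} (hg : Measurable g)
    (h : WeaklyConverges (fun t => (ρ t).map (W t)) Q)
    (hclose : ∀ ε : ℝ, 0 < ε → ∃ (U : Set E) (gc : E → E'), IsOpen U ∧ Q.real Uᶜ < ε ∧
      Continuous gc ∧ Measurable gc ∧ Set.EqOn gc g U ∧ ∀ η : ℝ, 0 < η → ∀ᶠ t in atTop, ∀ᵐ ω ∂(ρ t),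
        W t ω ∈ U → dist (Z t ω) (gc (W t ω)) ≤ η) :
    WeaklyConverges (fun t => (ρ t).map (Z t)) (Q.map g) := by
  have := h.2.1
  have hP : ∀ t : Set.Ioi (1 : ℝ), IsProbabilityMeasure ((ρ t).map (Z t)) := fun t =>
    have := hρ t t.2
    Measure.isProbabilityMeasure_map (hZ t).aemeasurable
  have hQg : IsProbabilityMeasure (Q.map g) := Measure.isProbabilityMeasure_map hg.aemeasurable
  rw [weaklyConverges_iff_tendsto hP hQg, tendsto_iff_forall_lipschitz_integral_tendsto]
  rintro f ⟨C, hC⟩ ⟨L, hL⟩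
  refine (tendsto_comp_val_Ioi_atTop (f := fun t => ∫ x, f x ∂((ρ t).map (Z t)))).2 ?_
  change Tendsto _ _ (𝓝 (∫ x, f x ∂(Q.map g)))
  have hfm : Measurable f := hL.continuous.measurable
  let fb : E' →ᵇ ℝ := ⟨⟨f, hL.continuous⟩, C, hC⟩
  have hC0 : 0 ≤ C := by
    have := nonempty_of_isProbabilityMeasure (Q.map g)
    exact dist_nonneg.trans (hC this.some this.some)
  rw [Metric.tendsto_nhds]
  intro ε hε
  -- Error budget: Lδ + Cδ for replacing Z by gc(W), δ for the weak convergence tested on f ∘ gc,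
  -- and Cδ for replacing gc by g under Q.
  obtain ⟨δ, hδ, hδε⟩ : ∃ δ : ℝ, 0 < δ ∧ L * δ + 2 * C * δ + δ < ε := by
    have hL0 : (0 : ℝ) ≤ L := L.2
    refine ⟨ε / (2 * (L + 2 * C + 1)), by positivity, ?_⟩
    have : (L : ℝ) * (ε / (2 * (L + 2 * C + 1))) + 2 * C * (ε / (2 * (L + 2 * C + 1))) +
        ε / (2 * (L + 2 * C + 1)) = ε / 2 := by field_simp
    linarith
  obtain ⟨U, gc, hU, hQU, hgc, hgcm, hgcU, hev⟩ := hclose δ hδ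
  have hlim := h.2.2 (fb.compContinuous ⟨gc, hgc⟩)
  have hQU' : Q Uᶜ < ENNReal.ofReal δ :=
    (ENNReal.lt_ofReal_iff_toReal_lt (measure_ne_top _ _)).2 hQU
  filter_upwards [hev δ hδ, h.eventually_measure_lt hU.isClosed_compl hQU',
    Metric.tendsto_nhds.1 hlim δ hδ, eventually_gt_atTop 1] with t h1 h2 h3 ht
  have := hρ t ht
  have hUm : MeasurableSet (W t ⁻¹' Uᶜ) := hW t hU.measurableSet.compl
  have e1 := abs_integral_comp_sub_le (ρ t) hC hL (hZ t) (hgcm.comp (hW t)) hUm hδ.le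
    (h1.mono fun ω hω hn => hω (by simpa using hn))
  have e2 := abs_integral_comp_sub_le Q hC hL hgcm hg hU.measurableSet.compl le_rfl
    (ae_of_all _ fun x hx => by rw [hgcU (by simpa using hx), dist_self])
  rw [Measure.map_apply (hW t) hU.measurableSet.compl,
    ENNReal.lt_ofReal_iff_toReal_lt (measure_ne_top _ _), ← measureReal_def] at h2
  rw [integral_map (hZ t).aemeasurable hfm.aestronglyMeasurable,
    integral_map hg.aemeasurable hfm.aestronglyMeasurable, Real.dist_eq]
  have hfgc : Measurable fun x => f (gc x) := hfm.comp hgcm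
  change dist (∫ x, f (gc x) ∂((ρ t).map (W t))) (∫ x, f (gc x) ∂Q) < δ at h3
  rw [integral_map (hW t).aemeasurable hfgc.aestronglyMeasurable, Real.dist_eq] at h3
  have h5 := mul_le_mul_of_nonneg_left h2.le hC0
  have h6 := mul_le_mul_of_nonneg_left hQU.le hC0
  rw [abs_lt] at h3 ⊢
  rw [abs_le] at e1 e2
  simp only [Function.comp_apply] at e1
  constructor <;> linarith

end Weak

/-! ### The unit Pareto law and the L₁-norm. -/

section Pareto

instance : IsProbabilityMeasure (paretoMeasure 1 1) :=
  isProbabilityMeasure_paretoMeasure one_pos one_pos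

lemma paretoMeasure_Ici (s : ℝ) : (paretoMeasure 1 1).real (Set.Ici s) = (max s 1)⁻¹ := by
  have hs : (0 : ℝ) < max s 1 := by positivity
  have h1 : (paretoMeasure 1 1).real (Set.Ici s) = ∫ x in Set.Ici s, paretoPDFReal 1 1 x := by
    rw [paretoMeasure, measureReal_def, withDensity_apply _ measurableSet_Ici]
    refine (integral_eq_lintegral_of_nonneg_ae ?_ ?_).symm
    · exact ae_of_all _ fun _ => paretoPDFReal_nonneg zero_le_one zero_le_one _
    · exact (measurable_paretoPDFReal 1 1).aestronglyMeasurable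
  have h2 : (Set.Ici s).indicator (paretoPDFReal 1 1) =
      (Set.Ici (max s 1)).indicator fun x => x ^ (-2 : ℝ) := by
    ext x
    simp only [Set.indicator, Set.mem_Ici, paretoPDFReal, max_le_iff]
    by_cases hx : s ≤ x <;> by_cases hx1 : 1 ≤ x <;> simp [hx, hx1]
    norm_num
  rw [h1, ← integral_indicator measurableSet_Ici, h2, integral_indicator measurableSet_Ici,
    integral_Ici_eq_integral_Ioi, integral_Ioi_rpow_of_lt (by norm_num) hs]
  norm_num [Real.rpow_neg_one]

lemma paretoMeasure_singleton (s : ℝ) : paretoMeasure 1 1 {s} = 0 :=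
  withDensity_absolutelyContinuous _ _ Real.volume_singleton

lemma ae_one_le_paretoMeasure : ∀ᵐ y ∂(paretoMeasure 1 1), 1 ≤ y := by
  have h : (paretoMeasure 1 1).real (Set.Ici 1) = 1 := by simp [paretoMeasure_Ici]
  have h2 : (paretoMeasure 1 1).real (Set.Ici 1)ᶜ = 0 := by
    rw [probReal_compl_eq_one_sub measurableSet_Ici, h, sub_self]
  exact (measureReal_eq_zero_iff).1 h2

end Pareto

section Norm

variable {d : ℕ}

lemma continuous_l1norm : Continuous (l1norm : (Fin d → ℝ) → ℝ) := by
  unfold l1norm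
  fun_prop

lemma l1norm_smul (c : ℝ) (x : Fin d → ℝ) : l1norm (c • x) = |c| * l1norm x := by
  simp [l1norm, abs_mul, Finset.mul_sum]

lemma l1norm_le (x : Fin d → ℝ) : l1norm x ≤ d * ‖x‖ := by
  calc l1norm x ≤ ∑ _j : Fin d, ‖x‖ := Finset.sum_le_sum fun j _ => norm_le_pi_norm x j
    _ = d * ‖x‖ := by simp

lemma le_l1norm (x : Fin d → ℝ) (j : Fin d) : x j ≤ l1norm x :=
  (le_abs_self _).trans
    (Finset.single_le_sum (f := fun j => |x j|) (fun _ _ => abs_nonneg _) (Finset.mem_univ j))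

end Norm

/-! ### Radius and angle of a regularly varying vector. -/

section Polar

variable {Ω : Type*} [MeasurableSpace Ω] {μ : Measure Ω} {d : ℕ}
  {V : Ω → Fin d → ℝ} {Φ : Measure (stdSimplex ℝ (Fin d))}

lemma measurable_l1norm (hVm : Measurable V) : Measurable fun ω => l1norm (V ω) :=
  continuous_l1norm.measurable.comp hVm

lemma measurableSet_le_l1norm (hVm : Measurable V) (t : ℝ) :
    MeasurableSet {ω | t ≤ l1norm (V ω)} :=
  measurableSet_le measurable_const (measurable_l1norm hVm)

lemma IsAngularMeasure.tendsto_angle (hVm : Measurable V) (hV0 : ∀ ω j, 0 ≤ V ω j)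
    (hΦ : IsAngularMeasure μ V Φ) {A : Set (Fin d → ℝ)} (hA : MeasurableSet A)
    (hA0 : Φ.map Subtype.val (frontier A) = 0) :
    Tendsto (fun t : ℝ => (μ[|{ω | t ≤ l1norm (V ω)}]) {ω | (l1norm (V ω))⁻¹ • V ω ∈ A})
      atTop (𝓝 (Φ.map Subtype.val A)) := by
  have hfr : Φ (frontier ((Subtype.val : stdSimplex ℝ (Fin d) → _) ⁻¹' A)) = 0 := by
    rw [Measure.map_apply measurable_subtype_coe isClosed_frontier.measurableSet] at hA0
    exact measure_mono_null (continuous_subtype_val.frontier_preimage_subset A) hA0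
  have h := hΦ.2 _ (measurable_subtype_coe hA) hfr
  rw [Measure.map_apply measurable_subtype_coe hA]
  refine h.congr' ?_
  filter_upwards [eventually_gt_atTop 0] with t ht
  have hm := measurableSet_le_l1norm hVm t
  rw [cond_apply hm, cond_apply hm]
  congr 2
  ext ω
  simp only [Set.mem_inter_iff, Set.mem_ofPred_eq, Set.mem_image, Set.mem_preimage]
  refine and_congr_right fun hω => ⟨?_, fun hωA => ?_⟩
  · rintro ⟨x, hx, hxV⟩
    rwa [← hxV]
  · have hR : 0 < l1norm (V ω) := ht.trans_le hω
    refine ⟨⟨(l1norm (V ω))⁻¹ • V ω, fun j => mul_nonneg (inv_pos.2 hR).le (hV0 ω j), ?_⟩, hωA, rfl⟩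
    simp only [Pi.smul_apply, smul_eq_mul, ← Finset.mul_sum]
    rw [show ∑ j, V ω j = l1norm (V ω) from
      Finset.sum_congr rfl fun j _ => (abs_of_nonneg (hV0 ω j)).symm, inv_mul_cancel₀ hR.ne']

/-- The tail of the radius of a regularly varying vector, along a continuity radius. -/
lemma IsRegularlyVarying.exists_tendsto_radius (hV0 : ∀ ω j, 0 ≤ V ω j)
    (hV : IsRegularlyVarying μ V) :
    ∃ r H : ℝ, 0 < r ∧ Tendsto (fun t => t * μ.real {ω | t * r ≤ l1norm (V ω)}) atTop (𝓝 H) := by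
  obtain ⟨ν, -, hfin, hlim⟩ := hV
  let g : puncturedOrthant d → ℝ := fun x => l1norm (x : Fin d → ℝ)
  have hg : Continuous g := continuous_l1norm.comp continuous_subtype_val
  have haway : ∀ r : ℝ, 0 < r → BoundedAwayFromZero {x | r ≤ g x} := fun r hr => by
    -- Dividing by d + 1 instead of d covers d = 0.
    refine ⟨r / (d + 1), by positivity, fun x hx => ?_⟩
    rw [div_le_iff₀ (by positivity)]
    have h1 := (show r ≤ g x from hx).trans (l1norm_le _)
    nlinarith [norm_nonneg (x : Fin d → ℝ)]
  have hmeas : ∀ r : ℝ, MeasurableSet {x | r ≤ g x} := fun r =>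
    measurableSet_le measurable_const hg.measurable
  -- On {g ≥ 1} the measure is finite, so all but countably many spheres are null; r > 1 places the
  -- sphere in that region.
  obtain ⟨r, hr1, hr⟩ : ∃ r : ℝ, 1 < r ∧ ν {x | g x = r} = 0 := by
    have : IsFiniteMeasure (ν.restrict {x | 1 ≤ g x}) :=
      ⟨by rw [Measure.restrict_apply_univ]; exact hfin _ (hmeas 1) (haway 1 one_pos)⟩
    have hc := Measure.countable_meas_level_set_pos (μ := ν.restrict {x | 1 ≤ g x}) hg.measurable
    obtain ⟨r, hr, hr1⟩ := (hc.dense_compl ℝ).exists_mem_open isOpen_Ioi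
      (Set.nonempty_Ioi (a := (1 : ℝ)))
    refine ⟨r, hr1, ?_⟩
    have h0 : (ν.restrict {x | 1 ≤ g x}) {x | g x = r} = 0 := by
      simpa using hr
    rw [Measure.restrict_apply' (hmeas 1)] at h0
    refine measure_mono_null (fun x hx => ?_) h0
    exact ⟨hx, (show (1 : ℝ) ≤ g x from (show g x = r from hx) ▸ (le_of_lt hr1))⟩
  have hr0 : 0 < r := one_pos.trans hr1
  have hfr : ν (frontier {x | r ≤ g x}) = 0 :=
    measure_mono_null (fun x hx => (frontier_le_subset_eq continuous_const hg hx).symm) hr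
  refine ⟨r, (ν {x | r ≤ g x}).toReal, hr0, ?_⟩
  have h := (ENNReal.tendsto_toReal (hfin _ (hmeas r) (haway r hr0)).ne).comp
    (hlim _ (hmeas r) (haway r hr0) hfr)
  refine h.congr' ?_
  filter_upwards [eventually_gt_atTop 0] with t ht
  simp only [Function.comp_apply, ENNReal.toReal_mul, ENNReal.toReal_ofReal ht.le]
  rw [← measureReal_def]
  congr 2
  ext ω
  have hl : l1norm (t⁻¹ • V ω) = t⁻¹ * l1norm (V ω) := by
    rw [l1norm_smul, abs_of_pos (inv_pos.2 ht)]
  have hiff : r ≤ l1norm (t⁻¹ • V ω) ↔ t * r ≤ l1norm (V ω) := by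
    rw [hl, le_inv_mul_iff₀ ht]
  constructor
  · rintro ⟨x, hx, hxV⟩
    refine hiff.1 ?_
    rw [← hxV]
    exact hx
  · intro hω
    have h1 := hiff.2 hω
    refine ⟨⟨t⁻¹ • V ω, fun j => mul_nonneg (inv_pos.2 ht).le (hV0 ω j), fun h0 => ?_⟩, h1, rfl⟩
    rw [h0] at h1
    simp [l1norm] at h1
    linarith

/-- A single continuity radius r suffices: substituting t/r for t shows that t P(|V|₁ ≥ t)
converges, and `hlow` bounds the limit below by 1, so the quotient is legitimate. -/
lemma IsRegularlyVarying.tendsto_radius_ratio (hV0 : ∀ ω j, 0 ≤ V ω j)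
    (hV : IsRegularlyVarying μ V) (hlow : ∀ t, 1 < t → 1 / t ≤ μ.real {ω | t ≤ l1norm (V ω)})
    {s : ℝ} (hs : 0 < s) :
    Tendsto (fun t => μ.real {ω | t * s ≤ l1norm (V ω)} / μ.real {ω | t ≤ l1norm (V ω)}) atTop
      (𝓝 s⁻¹) := by
  obtain ⟨r, H, hr, hlim⟩ := hV.exists_tendsto_radius hV0
  have h1 : Tendsto (fun t => t * μ.real {ω | t ≤ l1norm (V ω)}) atTop (𝓝 (r * H)) := by
    refine ((hlim.comp (tendsto_id.atTop_div_const hr)).const_mul r).congr fun t => ?_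
    simp only [Function.comp_apply, id_eq, div_mul_cancel₀ _ hr.ne']
    field_simp
  have hc : 1 ≤ r * H := by
    refine ge_of_tendsto h1 ?_
    filter_upwards [eventually_gt_atTop 1] with t ht
    have := hlow t ht
    rwa [div_le_iff₀ (by linarith), mul_comm] at this
  have h2 := h1.comp (tendsto_id.atTop_mul_const hs)
  have h3 := (h2.div h1 (by linarith)).const_mul s⁻¹
  rw [div_self (by linarith), mul_one] at h3
  refine h3.congr' ?_
  filter_upwards [eventually_gt_atTop 0] with t ht
  simp only [Pi.div_apply, Function.comp_apply, id_eq]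
  field_simp

/-- With m = max s 1, the probability factors as P(|V|₁ ≥ tm) / P(|V|₁ ≥ t) times the conditional
probability of A given |V|₁ ≥ tm. The factors tend to 1/m and to Φ(A), which yields independence in
the limit. -/
lemma tendsto_polar_Ici (hVm : Measurable V) (hV0 : ∀ ω j, 0 ≤ V ω j)
    (hV : IsRegularlyVarying μ V) (hlow : ∀ t, 1 < t → 1 / t ≤ μ.real {ω | t ≤ l1norm (V ω)})
    (hΦ : IsAngularMeasure μ V Φ) {A : Set (Fin d → ℝ)} (hA : MeasurableSet A)
    (hA0 : Φ.map Subtype.val (frontier A) = 0) (s : ℝ) :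
    Tendsto (fun t : ℝ => (μ[|{ω | t ≤ l1norm (V ω)}]).real
        {ω | s ≤ t⁻¹ * l1norm (V ω) ∧ (l1norm (V ω))⁻¹ • V ω ∈ A})
      atTop (𝓝 (((paretoMeasure 1 1).prod (Φ.map Subtype.val)).real (Set.Ici s ×ˢ A))) := by
  have := hΦ.1
  have : IsProbabilityMeasure (Φ.map (Subtype.val : _ → Fin d → ℝ)) :=
    Measure.isProbabilityMeasure_map measurable_subtype_coe.aemeasurable
  set m := max s 1 with hm
  have hm0 : 0 < m := by positivity
  have hm1 : 1 ≤ m := le_max_right _ _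
  rw [measureReal_prod_prod, paretoMeasure_Ici, ← hm]
  have h1 := (ENNReal.tendsto_toReal (measure_ne_top _ _)).comp
    ((hΦ.tendsto_angle hVm hV0 hA hA0).comp (tendsto_id.atTop_mul_const hm0))
  have h2 := (hV.tendsto_radius_ratio hV0 hlow hm0).mul h1
  refine h2.congr' ?_
  filter_upwards [eventually_gt_atTop 1] with t ht
  have ht0 : 0 < t := by linarith
  simp only [Function.comp_apply, id_eq]
  have hpos : ∀ x, 1 < x → μ.real {ω | x ≤ l1norm (V ω)} ≠ 0 := fun x hx =>
    ((show 0 < 1 / x by positivity).trans_le (hlow x hx)).ne'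
  rw [measureReal_def _ {ω | _ ∧ _}, cond_apply (measurableSet_le_l1norm hVm _),
    cond_apply (measurableSet_le_l1norm hVm _), ENNReal.toReal_mul, ENNReal.toReal_mul,
    ENNReal.toReal_inv, ENNReal.toReal_inv]
  simp only [← measureReal_def]
  have hset : {ω | t ≤ l1norm (V ω)} ∩
        {ω | s ≤ t⁻¹ * l1norm (V ω) ∧ (l1norm (V ω))⁻¹ • V ω ∈ A} =
      {ω | t * m ≤ l1norm (V ω)} ∩ {ω | (l1norm (V ω))⁻¹ • V ω ∈ A} := by
    ext ω
    simp only [Set.mem_inter_iff, Set.mem_ofPred_eq, le_inv_mul_iff₀ ht0, hm,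
      mul_max_of_nonneg _ _ ht0.le, max_le_iff, mul_one]
    tauto
  rw [hset]
  have := hpos t ht
  have := hpos (t * m) (by nlinarith)
  field_simp

variable [IsProbabilityMeasure μ]

/-- Weak convergence of the polar coordinates of `V` given a large radius. -/
lemma weaklyConverges_polar (hVm : Measurable V) (hV0 : ∀ ω j, 0 ≤ V ω j)
    (hV : IsRegularlyVarying μ V) (hlow : ∀ t, 1 < t → 1 / t ≤ μ.real {ω | t ≤ l1norm (V ω)})
    (hΦ : IsAngularMeasure μ V Φ) :
    WeaklyConverges (fun t => (μ[|{ω | t ≤ l1norm (V ω)}]).map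
        fun ω => (t⁻¹ * l1norm (V ω), (l1norm (V ω))⁻¹ • V ω))
      ((paretoMeasure 1 1).prod (Φ.map Subtype.val)) := by
  have := hΦ.1
  have : IsProbabilityMeasure (Φ.map (Subtype.val : _ → Fin d → ℝ)) :=
    Measure.isProbabilityMeasure_map measurable_subtype_coe.aemeasurable
  have hRm := measurable_l1norm hVm
  have hcond : ∀ t, 1 < t → IsProbabilityMeasure (μ[|{ω | t ≤ l1norm (V ω)}]) := fun t ht => by
    refine cond_isProbabilityMeasure fun h => ?_
    have h1 := hlow t ht
    rw [measureReal_def, h, ENNReal.toReal_zero] at h1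
    have : 0 < 1 / t := by positivity
    linarith
  have hpm : ∀ t : ℝ, Measurable fun ω => (t⁻¹ * l1norm (V ω), (l1norm (V ω))⁻¹ • V ω) := fun t =>
    (hRm.const_mul _).prodMk (hRm.inv.smul hVm)
  have hP : ∀ t : Set.Ioi (1 : ℝ), IsProbabilityMeasure ((μ[|{ω | (t : ℝ) ≤ l1norm (V ω)}]).map
      fun ω => ((t : ℝ)⁻¹ * l1norm (V ω), (l1norm (V ω))⁻¹ • V ω)) := fun t =>
    have := hcond t t.2
    Measure.isProbabilityMeasure_map (hpm t).aemeasurable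
  rw [weaklyConverges_iff_tendsto hP inferInstance]
  -- These rectangles form a π-system containing arbitrarily small neighbourhoods of each point, so
  -- convergence on them gives weak convergence; each is a difference of two sets covered by
  -- `tendsto_polar_Ici`.
  let S : Set (Set (ℝ × (Fin d → ℝ))) := {B | ∃ (a b : ℝ) (A : Set (Fin d → ℝ)),
    MeasurableSet A ∧ Φ.map Subtype.val (frontier A) = 0 ∧ B = Set.Ico a b ×ˢ A}
  have hS : IsPiSystem S := by
    rintro - ⟨a, b, A, hA, hA0, rfl⟩ - ⟨a', b', A', hA', hA0', rfl⟩ -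
    exact ⟨max a a', min b b', A ∩ A', hA.inter hA', null_frontier_inter hA0 hA0', by
      rw [Set.prod_inter_prod, Set.Ico_inter_Ico]⟩
  refine hS.tendsto_probabilityMeasure_of_tendsto_of_mem ?_ ?_ ?_
  · rintro - ⟨a, b, A, hA, hA0, rfl⟩
    exact measurableSet_Ico.prod hA
  · intro u hu x hx
    obtain ⟨ε, hε, hεu⟩ := Metric.isOpen_iff.1 hu x hx
    obtain ⟨r, hr, hr0⟩ := exists_null_frontier_thickening (Φ.map Subtype.val) {x.2} hε
    rw [Metric.thickening_singleton] at hr0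
    refine ⟨Set.Ico (x.1 - ε / 2) (x.1 + ε / 2) ×ˢ Metric.ball x.2 r,
      ⟨_, _, _, measurableSet_ball, hr0, rfl⟩, ?_, ?_⟩
    · exact prod_mem_nhds (Ico_mem_nhds (by linarith) (by linarith))
        (Metric.ball_mem_nhds _ hr.1)
    · rintro ⟨y, z⟩ ⟨hy, hz⟩
      refine hεu ?_
      rw [← ball_prod_same]
      refine ⟨?_, Metric.ball_subset_ball hr.2.le hz⟩
      rw [Metric.mem_ball, Real.dist_eq, abs_lt]
      constructor <;> linarith [hy.1, hy.2]
  · rintro - ⟨a, b, A, hA, hA0, rfl⟩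
    rw [← NNReal.tendsto_coe]
    change Tendsto (fun t : Set.Ioi (1 : ℝ) => ((μ[|{ω | (t : ℝ) ≤ l1norm (V ω)}]).map
      fun ω => ((t : ℝ)⁻¹ * l1norm (V ω), (l1norm (V ω))⁻¹ • V ω)).real (Set.Ico a b ×ˢ A)) atTop
      (𝓝 (((paretoMeasure 1 1).prod (Φ.map Subtype.val)).real (Set.Ico a b ×ˢ A)))
    rcases le_or_gt b a with hab | hab
    · simp [Set.Ico_eq_empty_of_le hab]
    have hdiff : Set.Ico a b ×ˢ A = (Set.Ici a ×ˢ A) \ (Set.Ici b ×ˢ A) := by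
      ext ⟨y, z⟩
      simp only [Set.mem_prod, Set.mem_Ico, Set.mem_sdiff, Set.mem_Ici]
      rw [← not_le]
      tauto
    have hsub : (Set.Ici b ×ˢ A) ⊆ (Set.Ici a ×ˢ A) :=
      Set.prod_mono (Set.Ici_subset_Ici.2 hab.le) subset_rfl
    rw [hdiff, measureReal_sdiff hsub (measurableSet_Ici.prod hA)]
    have h := (tendsto_polar_Ici hVm hV0 hV hlow hΦ hA hA0 a).sub
      (tendsto_polar_Ici hVm hV0 hV hlow hΦ hA hA0 b)
    refine (tendsto_comp_val_Ioi_atTop.2 h).congr fun t => ?_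
    have := hP t
    rw [measureReal_sdiff hsub (measurableSet_Ici.prod hA),
      map_measureReal_apply (hpm t) (measurableSet_Ici.prod hA),
      map_measureReal_apply (hpm t) (measurableSet_Ici.prod hA)]
    rfl

end Polar

/-! ### Regularity of the limit law. -/

section Limit

variable {d : ℕ} {Φ : Measure (stdSimplex ℝ (Fin d))}

/-- The law of `Y Θ`, with `Y` unit-Pareto and independent of `Θ ∼ Φ`. -/
noncomputable def paretoRay (Φ : Measure (stdSimplex ℝ (Fin d))) : Measure (Fin d → ℝ) :=
  ((paretoMeasure 1 1).prod Φ).map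
    (fun p : ℝ × stdSimplex ℝ (Fin d) => p.1 • (p.2 : Fin d → ℝ))

lemma measurable_ray :
    Measurable fun p : ℝ × stdSimplex ℝ (Fin d) => p.1 • (p.2 : Fin d → ℝ) :=
  measurable_fst.smul (measurable_subtype_coe.comp measurable_snd)

lemma measurableSet_not_le_one : MeasurableSet {z : Fin d → ℝ | ¬ z ≤ 1} :=
  (isClosed_le continuous_id continuous_const).measurableSet.compl

lemma frontier_not_le_one_subset :
    frontier {z : Fin d → ℝ | ¬ z ≤ 1} ⊆ ⋃ j, {z | z j = 1} := by
  intro z hz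
  have hz' : z ∈ frontier {z : Fin d → ℝ | z ≤ 1} := by
    rwa [← frontier_compl]
  rw [IsClosed.frontier_eq (isClosed_le continuous_id continuous_const :
    IsClosed {z : Fin d → ℝ | z ≤ 1})] at hz'
  obtain ⟨h1, h2⟩ := hz'
  by_contra hne
  simp only [Set.mem_iUnion, Set.mem_ofPred_eq, not_exists] at hne
  refine h2 (mem_interior.2 ⟨⋂ j, {z | z j < 1}, fun w hw j => ?_, ?_, ?_⟩)
  · exact (Set.mem_iInter.1 hw j).le
  · exact isOpen_iInter_of_finite fun j => isOpen_lt (continuous_apply j) continuous_const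
  · exact Set.mem_iInter.2 fun j => lt_of_le_of_ne (h1 j) (hne j)

/-- The concentration of Φ on the open simplex enters here; it keeps the limit away from the
singularity of `boxCox` at 0. -/
lemma ae_pos_multivariatePareto
    (hΦint : ∀ᵐ θ : stdSimplex ℝ (Fin d) ∂Φ, ∀ j, 0 < (θ : Fin d → ℝ) j) :
    ∀ᵐ z ∂(multivariatePareto Φ), ∀ j, 0 < z j := by
  refine cond_absolutelyContinuous.ae_le ?_
  have hm : MeasurableSet {z : Fin d → ℝ | ∀ j, 0 < z j} := by
    rw [Set.ofPred_forall]
    exact MeasurableSet.iInter fun j => measurableSet_lt measurable_const (measurable_pi_apply j)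
  refine (ae_map_iff measurable_ray.aemeasurable hm).2 ?_
  filter_upwards [Measure.quasiMeasurePreserving_fst.ae ae_one_le_paretoMeasure,
    Measure.quasiMeasurePreserving_snd.ae hΦint] with p h1 h2 j
  exact mul_pos (by linarith) (h2 j)

variable [IsProbabilityMeasure Φ]

/-- For fixed θ the equation y θ_j = 1 has at most one solution y, and the Pareto law has no atoms.
-/
lemma paretoRay_frontier : paretoRay Φ (frontier {z | ¬ z ≤ 1}) = 0 := by
  refine measure_mono_null frontier_not_le_one_subset (measure_iUnion_null fun j => ?_)
  have hm : MeasurableSet {z : Fin d → ℝ | z j = 1} :=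
    (isClosed_eq (continuous_apply j) continuous_const).measurableSet
  rw [paretoRay, Measure.map_apply measurable_ray hm, Measure.prod_apply_symm (measurable_ray hm),
    lintegral_eq_zero_iff (measurable_measure_prodMk_right (measurable_ray hm))]
  refine ae_of_all _ fun θ => measure_mono_null (fun y hy => ?_)
    (paretoMeasure_singleton ((θ : Fin d → ℝ) j)⁻¹)
  have h : y * (θ : Fin d → ℝ) j = 1 := hy
  exact eq_inv_of_mul_eq_one_left h

/-- If yθ ≤ 1 then summing coordinates gives y ≤ d, whereas Y ≥ d + 1 has positive probability. -/
lemma paretoRay_not_le_one_ne_zero : paretoRay Φ {z | ¬ z ≤ 1} ≠ 0 := by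
  intro h0
  rw [paretoRay, Measure.map_apply measurable_ray measurableSet_not_le_one] at h0
  have h1 : ((paretoMeasure 1 1).prod Φ) (Set.Ici (d + 1 : ℝ) ×ˢ Set.univ) = 0 := by
    refine measure_mono_null (fun p hp => ?_) h0
    intro hle
    have hp1 : (d + 1 : ℝ) ≤ p.1 := hp.1
    have h2 : ∑ j, p.1 * (p.2 : Fin d → ℝ) j ≤ ∑ _j : Fin d, (1 : ℝ) :=
      Finset.sum_le_sum fun j _ => hle j
    have h3 : ∑ j, (p.2 : Fin d → ℝ) j = 1 := p.2.2.2
    rw [← Finset.mul_sum, h3] at h2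
    simp at h2
    linarith
  have h3 := paretoMeasure_Ici (d + 1)
  rw [Measure.prod_prod, measure_univ, mul_one] at h1
  rw [measureReal_def, h1, ENNReal.toReal_zero] at h3
  have : (0 : ℝ) < (max (d + 1 : ℝ) 1)⁻¹ := by positivity
  linarith

end Limit

/-! ### From a large radius to a large coordinate. -/

section Vector

variable {Ω : Type*} [MeasurableSpace Ω] {μ : Measure Ω} [IsProbabilityMeasure μ] {d : ℕ}
  {V : Ω → Fin d → ℝ} {Φ : Measure (stdSimplex ℝ (Fin d))}

/-- Weak convergence of `V / t` given a large radius. -/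
lemma weaklyConverges_paretoRay (hVm : Measurable V) (hV0 : ∀ ω j, 0 ≤ V ω j)
    (hV : IsRegularlyVarying μ V) (hlow : ∀ t, 1 < t → 1 / t ≤ μ.real {ω | t ≤ l1norm (V ω)})
    (hΦ : IsAngularMeasure μ V Φ) :
    WeaklyConverges (fun t => (μ[|{ω | t ≤ l1norm (V ω)}]).map fun ω => t⁻¹ • V ω)
      (paretoRay Φ) := by
  have := hΦ.1
  have hRm := measurable_l1norm hVm
  have h := (weaklyConverges_polar hVm hV0 hV hlow hΦ).map
    (g := fun p : ℝ × (Fin d → ℝ) => p.1 • p.2) (by fun_prop)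
  have hQ : ((paretoMeasure 1 1).prod (Φ.map Subtype.val)).map
      (fun p : ℝ × (Fin d → ℝ) => p.1 • p.2) = paretoRay Φ := by
    conv_lhs => rw [← Measure.map_id (μ := paretoMeasure 1 1)]
    rw [Measure.map_prod_map _ _ measurable_id measurable_subtype_coe,
      Measure.map_map (by fun_prop) (measurable_id.prodMap measurable_subtype_coe)]
    rfl
  rw [hQ] at h
  have hP : ∀ t : ℝ, 1 < t → ((μ[|{ω | t ≤ l1norm (V ω)}]).map
      fun ω => (t⁻¹ * l1norm (V ω), (l1norm (V ω))⁻¹ • V ω)).map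
      (fun p : ℝ × (Fin d → ℝ) => p.1 • p.2) =
      (μ[|{ω | t ≤ l1norm (V ω)}]).map fun ω => t⁻¹ • V ω := fun t ht => by
    have hm : Measurable fun ω => (t⁻¹ * l1norm (V ω), (l1norm (V ω))⁻¹ • V ω) :=
      (hRm.const_mul _).prodMk (hRm.inv.smul hVm)
    rw [Measure.map_map (by fun_prop) hm]
    refine Measure.map_congr ?_
    filter_upwards [ae_cond_mem (measurableSet_le_l1norm hVm t)] with ω hω
    have hR : l1norm (V ω) ≠ 0 := by
      have : t ≤ l1norm (V ω) := hω
      linarith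
    simp only [Function.comp_apply, smul_smul]
    rw [mul_inv_cancel_right₀ hR]
  exact h.congr hP

/-- Weak convergence of `V / t` given `V ≰ t`. -/
lemma weaklyConverges_multivariatePareto (hVm : Measurable V) (hV0 : ∀ ω j, 0 ≤ V ω j)
    (hV : IsRegularlyVarying μ V) (hlow : ∀ t, 1 < t → ∃ j, 1 / t ≤ μ.real {ω | t < V ω j})
    (hΦ : IsAngularMeasure μ V Φ) :
    WeaklyConverges (fun t => (μ[|{ω | ¬ V ω ≤ fun _ => t}]).map fun ω => t⁻¹ • V ω)
      (multivariatePareto Φ) := by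
  have := hΦ.1
  have hlow' : ∀ t, 1 < t → 1 / t ≤ μ.real {ω | t ≤ l1norm (V ω)} := fun t ht => by
    obtain ⟨j, hj⟩ := hlow t ht
    exact hj.trans (measureReal_mono fun ω (hω : t < V ω j) => hω.le.trans (le_l1norm _ _))
  have hWm : ∀ t : ℝ, Measurable fun ω => t⁻¹ • V ω := fun t => hVm.const_smul t⁻¹
  have hCm : ∀ t : ℝ, MeasurableSet {ω | ¬ V ω ≤ fun _ => t} := fun t =>
    (measurableSet_le hVm measurable_const).compl
  have hpre : ∀ t : ℝ, 0 < t → (fun ω => t⁻¹ • V ω) ⁻¹' {z | ¬ z ≤ 1} =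
      {ω | ¬ V ω ≤ fun _ => t} := fun t ht => by
    ext ω
    simp only [Set.mem_preimage, Set.mem_ofPred_eq, Pi.le_def, Pi.smul_apply, smul_eq_mul,
      Pi.one_apply, inv_mul_le_iff₀ ht, mul_one]
  have hsub : ∀ t : ℝ, {ω | ¬ V ω ≤ fun _ => t} ⊆ {ω | t ≤ l1norm (V ω)} := fun t ω hω => by
    simp only [Set.mem_ofPred_eq, Pi.le_def, not_forall, not_le] at hω
    obtain ⟨j, hj⟩ := hω
    exact hj.le.trans (le_l1norm _ _)
  have hpos : ∀ t : ℝ, 1 < t → μ {ω | ¬ V ω ≤ fun _ => t} ≠ 0 := fun t ht h0 => by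
    obtain ⟨j, hj⟩ := hlow t ht
    have h1 : μ {ω | t < V ω j} = 0 :=
      measure_mono_null (fun ω hω => show ¬ V ω ≤ fun _ => t from fun hle => hω.not_ge (hle j)) h0
    rw [measureReal_def, h1, ENNReal.toReal_zero] at hj
    have : 0 < 1 / t := by positivity
    linarith
  -- As V ≰ t forces |V|₁ ≥ t, conditioning on both in turn is conditioning on V ≰ t alone.
  have hcc : ∀ t : ℝ, μ[|{ω | t ≤ l1norm (V ω)}][|{ω | ¬ V ω ≤ fun _ => t}] =
      μ[|{ω | ¬ V ω ≤ fun _ => t}] := fun t => by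
    rw [cond_cond_eq_cond_inter (measurableSet_le_l1norm hVm t) (hCm t),
      Set.inter_eq_self_of_subset_right (hsub t)]
  have h := (weaklyConverges_paretoRay hVm hV0 hV hlow' hΦ).cond measurableSet_not_le_one
    paretoRay_frontier paretoRay_not_le_one_ne_zero fun t ht => by
      rw [Measure.map_apply (hWm t) measurableSet_not_le_one, hpre t (by linarith)]
      have h1 := cond_pos_of_inter_ne_zero (μ := μ) (t := {ω | ¬ V ω ≤ fun _ => t})
        (measurableSet_le_l1norm hVm t) (by
          rw [Set.inter_eq_self_of_subset_right (hsub t)]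
          exact hpos t ht)
      exact h1.ne'
  have hP : ∀ t : ℝ, 1 < t →
      ((μ[|{ω | t ≤ l1norm (V ω)}]).map fun ω => t⁻¹ • V ω)[|{z | ¬ z ≤ 1}] =
      (μ[|{ω | ¬ V ω ≤ fun _ => t}]).map fun ω => t⁻¹ • V ω := fun t ht => by
    ext A hA
    rw [cond_apply measurableSet_not_le_one, Measure.map_apply (hWm t) measurableSet_not_le_one,
      Measure.map_apply (hWm t) (measurableSet_not_le_one.inter hA), Measure.map_apply (hWm t) hA,
      Set.preimage_inter, hpre t (by linarith), ← hcc t, cond_apply (hCm t)]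
  exact h.congr hP

end Vector

/-! ### From V back to the excesses of X. -/

section Excess

variable {Ω : Type*} [MeasurableSpace Ω] {μ : Measure Ω} [IsProbabilityMeasure μ] {d : ℕ}
  {X : Ω → Fin d → ℝ} {Φ : Measure (stdSimplex ℝ (Fin d))}

/-- A law carried by the positive orthant is nearly carried by a box. -/
lemma exists_measureReal_box_compl_lt {Q : Measure (Fin d → ℝ)} [IsFiniteMeasure Q]
    (hQ : ∀ᵐ z ∂Q, ∀ j, 0 < z j) {ε : ℝ} (hε : 0 < ε) :
    ∃ p q : ℝ, 0 < p ∧ p ≤ q ∧ Q.real {z | ∀ j, p < z j ∧ z j < q}ᶜ < ε := by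
  let U : ℕ → Set (Fin d → ℝ) := fun n => {z | ∀ j, 1 / ((n : ℝ) + 1) < z j ∧ z j < n + 1}
  have hU : ∀ n, MeasurableSet (U n) := fun n => by
    refine IsOpen.measurableSet ?_
    simp only [U, Set.ofPred_forall]
    exact isOpen_iInter_of_finite fun j => (isOpen_lt continuous_const (continuous_apply j)).inter
      (isOpen_lt (continuous_apply j) continuous_const)
  have hmono : Monotone U := fun n m hnm z hz j => by
    have h1 : (n : ℝ) ≤ m := by exact_mod_cast hnm
    refine ⟨lt_of_le_of_lt ?_ (hz j).1, (hz j).2.trans_le (by linarith)⟩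
    exact one_div_le_one_div_of_le (by positivity) (by linarith)
  have hlim := tendsto_measure_iInter_atTop (μ := Q) (s := fun n => (U n)ᶜ)
    (fun n => (hU n).compl.nullMeasurableSet)
    (fun n m hnm => Set.compl_subset_compl.2 (hmono hnm)) ⟨0, measure_ne_top _ _⟩
  have h0 : Q (⋂ n, (U n)ᶜ) = 0 := by
    refine measure_mono_null (fun z hz => ?_) hQ
    intro hpos
    rw [← Set.compl_iUnion] at hz
    refine hz (Set.mem_iUnion.2 ?_)
    have hev : ∀ᶠ n : ℕ in atTop, z ∈ U n := by
      refine eventually_all.2 fun j => ?_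
      have h1 := (tendsto_one_div_add_atTop_nhds_zero_nat (𝕜 := ℝ)).eventually_lt_const (hpos j)
      filter_upwards [h1, (tendsto_natCast_atTop_atTop (R := ℝ)).eventually_ge_atTop (z j)]
        with n hn1 hn2
      exact ⟨hn1, by linarith⟩
    exact hev.exists
  rw [h0] at hlim
  obtain ⟨n, hn⟩ := (hlim.eventually_lt_const (ENNReal.ofReal_pos.2 hε)).exists
  refine ⟨1 / ((n : ℝ) + 1), n + 1, by positivity, ?_, ?_⟩
  · rw [div_le_iff₀ (by positivity)]
    nlinarith [Nat.cast_nonneg (α := ℝ) n]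
  · exact (ENNReal.lt_ofReal_iff_toReal_lt (measure_ne_top _ _)).1 hn

lemma weaklyConverges_excessLaw (hX : Measurable X) (hF : ∀ j, Continuous (marginCDF μ X j))
    (hV : IsRegularlyVarying μ (unitPareto μ X)) (hΦ : IsAngularMeasure μ (unitPareto μ X) Φ)
    (hΦint : ∀ᵐ θ : stdSimplex ℝ (Fin d) ∂Φ, ∀ j, 0 < (θ : Fin d → ℝ) j) {ξ : Fin d → ℝ}
    {a : Fin d → ℝ → ℝ} (ha : ∀ j, IsTailScaling μ X j (ξ j) (a j)) :
    WeaklyConverges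
      (fun t => excessLaw μ X (fun j => tailQuantile μ X j t) (fun j => a j t)) (mgpLaw Φ ξ) := by
  have := hΦ.1
  have hVm := measurable_unitPareto (μ := μ) hX
  -- For d = 0 the simplex is empty and carries no probability measure. A coordinate is needed for
  -- the lower bound 1/t.
  have hd : Nonempty (Fin d) := by
    obtain ⟨θ⟩ := nonempty_of_isProbabilityMeasure Φ
    by_contra hne
    rw [not_nonempty_iff] at hne
    simpa using θ.2.2
  have hW := weaklyConverges_multivariatePareto hVm unitPareto_nonneg hV
    (fun t ht => ⟨hd.some, (measureReal_lt_unitPareto hX (hF _) ht).ge⟩) hΦ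
  have hρ : ∀ t : ℝ, 1 < t →
      IsProbabilityMeasure (μ[|{ω | ¬ unitPareto μ X ω ≤ fun _ => t}]) := fun t ht =>
    have := hW.1 t ht
    Measure.isProbabilityMeasure_of_map fun ω => t⁻¹ • unitPareto μ X ω
  have hg : Measurable fun (y : Fin d → ℝ) j => boxCox (ξ j) (y j) :=
    measurable_pi_lambda _ fun j => (measurable_boxCox _).comp (measurable_pi_apply j)
  have := hW.2.1
  have h := weaklyConverges_map_of_close hρ (fun t => hVm.const_smul t⁻¹)
    (Z := fun t ω j => (X ω j - tailQuantile μ X j t) / a j t)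
    (fun t => measurable_pi_lambda _ fun j => by fun_prop) hg hW fun ε hε => by
      obtain ⟨p, q, hp, hpq, hQ⟩ :=
        exists_measureReal_box_compl_lt (ae_pos_multivariatePareto hΦint) hε
      -- Truncation at p gives a map continuous on the whole space that agrees with `boxCox` on the
      -- box.
      have hgc : Continuous fun (y : Fin d → ℝ) j => boxCox (ξ j) (max p (y j)) :=
        continuous_pi fun j => (continuousOn_boxCox (ξ j)).comp_continuous (by fun_prop)
          fun y => lt_max_of_lt_left hp
      refine ⟨_, _, ?_, hQ, hgc, hgc.measurable, fun y hy => ?_, fun η hη => ?_⟩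
      · simp only [Set.ofPred_forall]
        exact isOpen_iInter_of_finite fun j =>
          (isOpen_lt continuous_const (continuous_apply j)).inter
            (isOpen_lt (continuous_apply j) continuous_const)
      · funext j
        simp only [max_eq_right (hy j).1.le]
      · have hunif : ∀ j, ∀ᶠ t in atTop, ∀ y ∈ Set.Icc p q,
            |(tailQuantile μ X j (t * y) - tailQuantile μ X j t) / a j t - boxCox (ξ j) y| ≤ η :=
          fun j => by
            refine eventually_forall_abs_sub_le_of_monotoneOn ?_
              ((continuousOn_boxCox (ξ j)).mono fun y hy => hp.trans_le hy.1)
              (fun y hy => (ha j).tendsto hX (hF j) (hp.trans_le hy.1)) hη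
            -- Once tp > 1, all arguments ty with y in [p, q] lie where the tail quantile is
            -- monotone.
            filter_upwards [eventually_gt_atTop 1, eventually_gt_atTop p⁻¹] with t ht htp
              y hy z hz hyz
            have ht0 : 0 < t := by linarith
            have h1 : 1 < t * p := by rwa [inv_lt_iff_one_lt_mul₀ hp] at htp
            have hty : ∀ x ∈ Set.Icc p q, 1 < t * x := fun x hx =>
              h1.trans_le (mul_le_mul_of_nonneg_left hx.1 ht0.le)
            have h2 := (strictMonoOn_tailQuantile (hF j)).monotoneOn (hty y hy) (hty z hz)
              (mul_le_mul_of_nonneg_left hyz ht0.le)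
            exact div_le_div_of_nonneg_right (by linarith) ((ha j).1 t ht).le
        filter_upwards [eventually_all.2 hunif, eventually_gt_atTop 1] with t hu ht
        have hae := ae_all_iff.2 fun j => ae_eq_tailQuantile_unitPareto hX (hF j)
        filter_upwards [cond_absolutelyContinuous.ae_le hae] with ω hω hωU
        refine (dist_pi_le_iff hη.le).2 fun j => ?_
        have h1 := hu j _ ⟨(hωU j).1.le, (hωU j).2.le⟩
        simp only [Pi.smul_apply, smul_eq_mul] at h1 hωU ⊢
        -- At y = V_j / t the term b_j(t y) is b_j(V_j) = X_j.
        rw [mul_inv_cancel_left₀ (by linarith), (hω j).2] at h1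
        rwa [Real.dist_eq, max_eq_right (hωU j).1.le]
  have hP : ∀ t : ℝ, 1 < t →
      (μ[|{ω | ¬ unitPareto μ X ω ≤ fun _ => t}]).map
        (fun ω j => (X ω j - tailQuantile μ X j t) / a j t) =
      excessLaw μ X (fun j => tailQuantile μ X j t) (fun j => a j t) := fun t ht => by
    have hset := ae_not_le_iff hX hF ht
    rw [excessLaw, ProbabilityTheory.cond, ProbabilityTheory.cond, measure_congr hset,
      Measure.restrict_congr_set hset]
  exact h.congr hP

end Excess

end MGP

theorem proposition1 {Ω : Type*} [MeasurableSpace Ω] (μ : Measure Ω) [IsProbabilityMeasure μ]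
    (d : ℕ) (X : Ω → Fin d → ℝ) (hX : Measurable X)
    (hF : ∀ j, Continuous (MGP.marginCDF μ X j))
    (hV : MGP.IsRegularlyVarying μ (MGP.unitPareto μ X))
    (Φ : Measure (stdSimplex ℝ (Fin d)))
    (hΦ : MGP.IsAngularMeasure μ (MGP.unitPareto μ X) Φ)
    (hΦint : ∀ᵐ θ : stdSimplex ℝ (Fin d) ∂Φ, ∀ j, 0 < (θ : Fin d → ℝ) j)
    (ξ : Fin d → ℝ) (σ : Fin d → ℝ → ℝ)
    (hσ : ∀ j, MGP.HasGPTail μ X j (ξ j) (σ j)) :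
    (∀ a : Fin d → ℝ → ℝ, (∀ j, MGP.IsTailScaling μ X j (ξ j) (a j)) →
      MGP.WeaklyConverges
        (fun t => MGP.excessLaw μ X (fun j => MGP.tailQuantile μ X j t) (fun j => a j t))
        (MGP.mgpLaw Φ ξ)) ∧
    MGP.WeaklyConverges
      (fun t => MGP.excessLaw μ X (fun j => MGP.tailQuantile μ X j t)
        (fun j => σ j (MGP.tailQuantile μ X j t)))
      (MGP.mgpLaw Φ ξ) :=
  ⟨fun _ ha => MGP.weaklyConverges_excessLaw hX hF hV hΦ hΦint ha,
    MGP.weaklyConverges_excessLaw hX hF hV hΦ hΦint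
      (a := fun j t => σ j (MGP.tailQuantile μ X j t))
      fun j => (hσ j).isTailScaling (hF j)⟩
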